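/- Let $M$ be a finite-dimensional smooth Riemannian manifold (Hausdorff, without boundary) with metric $ds^2_M=\langle\cdot,\cdot\rangle_M$, and let $G$ be a Lie group acting smoothly on $M$ by isometries. Let $I_0,I_1:(0,\infty)\to(0,\infty)$ be smooth, and equip $\mathcal M=M\times(0,\infty)$ with the warped metric $ds^2=I_0(\sigma)\,d\sigma^2+I_1(\sigma)\,ds^2_M$. Let $\gamma(t)=(x(t),\sigma(t))$, $t\in J$, be an affinely parameterised geodesic of $ds^2$, where $J$ is an open interval containing $0$. (1) The energy $E=I_0(\sigma)\dot\sigma^2+I_1(\sigma)\|\dot x\|^2$ is constant along $\gamma$ and, for each $\xi$ in the Lie algebra of $G$, the moment $J(\xi)=I_1(\sigma)\langle\dot x,X_\xi\rangle_M$ is constant along $\gamma$, where $X_\xi(x)=\frac{d}{dt}\big|_{t=0}e^{t\xi}\cdot x$. (2) Suppose that $M$ is an irreducible Riemannian symmetric space under $G$: $M$ is connected, for each $p\in M$ there is an isometry of $M$ fixing $p$ with differential $-\mathrm{id}$ at $p$, $G$ is transitive on $M$, and for each $p$ the stabiliser of $p$ in $G$ acts irreducibly on $T_pM\neq 0$.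 Then, for all $t\in J$, $$x(t)=\mathrm{Exp}_{x(0)}\left[\left(\int_0^t\frac{I_1(\sigma(0))}{I_1(\sigma(s))}\,ds\right)\dot x(0)\right],$$ where $\mathrm{Exp}$ is the Riemannian exponential map of $M$ (the vector in brackets being in its domain). Moreover, with $J_0=I_1(\sigma(0))\|\dot x(0)\|^2$ and $V(\sigma)=J_0\,I_1(\sigma(0))/I_1(\sigma)$, one has $I_0(\sigma)\dot\sigma^2=E-V(\sigma)$ on $J$ and, for all $t_0,t\in J$ such that $\dot\sigma$ has no zero strictly between $t_0$ and $t$ (in particular for $t_0=0$), $$t-t_0=\pm\int_{\sigma(t_0)}^{\sigma(t)}\frac{I_0^{1/2}(\sigma)\,d\sigma}{\sqrt{E-V(\sigma)}},$$ where the integral converges absolutely and the sign is that of $\dot\sigma$ between $t_0$ and $t$. -/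

import Mathlib

open Set Manifold MeasureTheory
open scoped ContDiff Topology

noncomputable section

section Geodesics

variable {E : Type*} [NormedAddCommGroup E] [NormedSpace ℝ E]
  {H : Type*} [TopologicalSpace H] (I : ModelWithCorners ℝ E H)
  {M : Type*} [TopologicalSpace M] [ChartedSpace H M]

/-- The velocity `ċ(t)` of a curve `c` in the manifold `M`. -/
def curveVelocity (c : ℝ → M) (t : ℝ) : TangentSpace I (c t) :=
  mfderiv 𝓘(ℝ, ℝ) I c t (1 : ℝ)

/-- The components `g_u(a, b)` of a metric tensor `g` in the coordinates given by the chart `e`: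
`a` and `b` are constant coordinate vectors, and `u` is a point of the image of the chart. -/
def metricInChart (g : ∀ p : M, TangentSpace I p → TangentSpace I p → ℝ)
    (e : OpenPartialHomeomorph M H) (u a b : E) : ℝ :=
  g ((e.extend I).symm u)
    (mfderiv 𝓘(ℝ, E) I (e.extend I).symm u a) (mfderiv 𝓘(ℝ, E) I (e.extend I).symm u b)

/-- The Christoffel symbols of the first kind of `g` in the chart `e`,
`Γ_u(a, b; w) = (∂_a g(b, w) + ∂_b g(a, w) - ∂_w g(a, b)) / 2`. -/
def christoffelInChart (g : ∀ p : M, TangentSpace I p → TangentSpace I p → ℝ)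
    (e : OpenPartialHomeomorph M H) (u a b w : E) : ℝ :=
  (fderiv ℝ (fun u' => metricInChart I g e u' b w) u a
    + fderiv ℝ (fun u' => metricInChart I g e u' a w) u b
    - fderiv ℝ (fun u' => metricInChart I g e u' a b) u w) / 2

/-- `c` is an (affinely parameterised) geodesic of the metric tensor `g` on the open set `J` of
times: it is smooth there, and in each chart of the atlas its coordinate expression `u` satisfies
the geodesic equation `g_u(ü, w) + Γ_u(u̇, u̇; w) = 0` for each coordinate vector `w`, that is,
`∇_ċ ċ = 0` for the Levi-Civita connection. (The manifold is understood to have no boundary.) -/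
def IsGeodesicOn (g : ∀ p : M, TangentSpace I p → TangentSpace I p → ℝ)
    (c : ℝ → M) (J : Set ℝ) : Prop :=
  ContMDiffOn 𝓘(ℝ, ℝ) I ∞ c J ∧
    ∀ t ∈ J, ∀ e ∈ atlas H M, c t ∈ e.source → ∀ w : E,
      metricInChart I g e (e.extend I (c t))
          (deriv (deriv (fun s => e.extend I (c s))) t) w
        + christoffelInChart I g e (e.extend I (c t))
          (deriv (fun s => e.extend I (c s)) t) (deriv (fun s => e.extend I (c s)) t) w = 0

/-- `c` is a geodesic, defined on an open interval that contains `[0, 1]`, with initial point `p`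
and initial velocity `v`. -/
def IsExpGeodesic (g : ∀ p : M, TangentSpace I p → TangentSpace I p → ℝ)
    (p : M) (v : TangentSpace I p) (c : ℝ → M) : Prop :=
  (∃ J : Set ℝ, IsOpen J ∧ J.OrdConnected ∧ Icc 0 1 ⊆ J ∧ IsGeodesicOn I g c J) ∧
    (⟨c 0, curveVelocity I c 0⟩ : TangentBundle I M) = ⟨p, v⟩

/-- The domain of the Riemannian exponential map at `p`. -/
def riemannianExpDomain (g : ∀ p : M, TangentSpace I p → TangentSpace I p → ℝ)
    (p : M) : Set (TangentSpace I p) :=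
  {v | ∃ c : ℝ → M, IsExpGeodesic I g p v c}

open Classical in
/-- The Riemannian exponential map `Exp_p v = c(1)`, where `c` is the geodesic with `c(0) = p` and
`ċ(0) = v`. Outside of its domain it has the junk value `p`. -/
def riemannianExp (g : ∀ p : M, TangentSpace I p → TangentSpace I p → ℝ)
    (p : M) (v : TangentSpace I p) : M :=
  if h : ∃ c : ℝ → M, IsExpGeodesic I g p v c then h.choose 1 else p

/-- A map preserves the metric tensor `g`. -/
def PreservesMetric (g : ∀ p : M, TangentSpace I p → TangentSpace I p → ℝ) (f : M → M) : Prop :=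
  ∀ (p : M) (v w : TangentSpace I p),
    g (f p) (mfderiv I I f p v) (mfderiv I I f p w) = g p v w

/-- `M`, with the metric tensor `g` and the group of isometries `G`, is an irreducible Riemannian
symmetric space. -/
structure IsIrreducibleSymmetricSpace
    (g : ∀ p : M, TangentSpace I p → TangentSpace I p → ℝ)
    (G : Type*) [Group G] [MulAction G M] : Prop where
  /-- `M` is connected. -/
  connected : ConnectedSpace M
  /-- Each point `p` has a geodesic symmetry: an isometry that fixes `p` and whose differential
  at `p` is `-id`. -/
  symmetry : ∀ p : M, ∃ s : M ≃ₘ^∞⟮I, I⟯ M, PreservesMetric I g s ∧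
    ∀ v : TangentSpace I p, (⟨s p, mfderiv I I s p v⟩ : TangentBundle I M) = ⟨p, -v⟩
  /-- The group `G` is transitive on `M`. -/
  transitive : MulAction.IsPretransitive G M
  /-- The tangent spaces are not zero. -/
  nontrivial : ∀ p : M, Nontrivial (TangentSpace I p)
  /-- The isotropy representation of the stabiliser of `p` in the tangent space at `p` is
  irreducible: it has no invariant subspaces except `0` and the whole space. -/
  irreducible : ∀ (p : M) (W : Submodule ℝ (TangentSpace I p)),
    (∀ k : G, k • p = p → ∀ v ∈ W, ∃ w ∈ W,
      (⟨k • p, mfderiv I I (fun q => k • q) p v⟩ : TangentBundle I M) = ⟨p, w⟩) →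
    W = ⊥ ∨ W = ⊤

end Geodesics

section LieGroupAction

variable {F : Type*} [NormedAddCommGroup F] [NormedSpace ℝ F]
  {G : Type*} [TopologicalSpace G] [ChartedSpace F G] [Group G] [LieGroup 𝓘(ℝ, F) ∞ G]

theorem mulInvariantVectorField_mul (ξ : GroupLieAlgebra 𝓘(ℝ, F) G) (a b : G) :
    mfderiv 𝓘(ℝ, F) 𝓘(ℝ, F) (fun h : G => a * h) b (mulInvariantVectorField ξ b)
      = mulInvariantVectorField ξ (a * b) := by
  have hd : ∀ a b : G, MDifferentiableAt 𝓘(ℝ, F) 𝓘(ℝ, F) (fun h : G => a * h) b := fun a b =>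
    (contMDiff_mul_left (I := 𝓘(ℝ, F)) (n := ∞) (a := a)).contMDiffAt.mdifferentiableAt (by simp)
  have h1 : (fun h : G => a * b * h) = (fun h => a * h) ∘ (fun h => b * h) := by
    funext h; simp [mul_assoc]
  unfold mulInvariantVectorField
  rw [h1, mfderiv_comp (I' := 𝓘(ℝ, F)) (1 : G) (by simpa using hd a (b * 1)) (hd b 1)]
  have h2 : ∀ c, c = b → ∀ v : F, (mfderiv 𝓘(ℝ, F) 𝓘(ℝ, F) (fun h : G => a * h) b v : F)
      = mfderiv 𝓘(ℝ, F) 𝓘(ℝ, F) (fun h : G => a * h) c v := by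
    rintro c rfl v; rfl
  exact h2 (b * 1) (mul_one b) _

variable [FiniteDimensional ℝ F] [T2Space G]

theorem exists_oneParameterSubgroup (ξ : GroupLieAlgebra 𝓘(ℝ, F) G) :
    ∃ φ : ℝ → G, φ 0 = 1 ∧
      IsMIntegralCurve φ (mulInvariantVectorField (I := 𝓘(ℝ, F)) (G := G) ξ) := by
  have : CompleteSpace F := FiniteDimensional.complete ℝ F
  have : LieGroup 𝓘(ℝ, F) (minSmoothness ℝ 3) G :=
    LieGroup.of_le (n := ∞) (by
      rw [minSmoothness_of_isRCLikeNormedField]; exact ENat.LEInfty.out)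
  have : IsManifold 𝓘(ℝ, F) 1 G := IsManifold.of_le (n := ∞) ENat.LEInfty.out
  have hv : CMDiff 1 (fun g : G =>
      (mulInvariantVectorField ξ g : TangentBundle 𝓘(ℝ, F) G)) :=
    (contMDiff_mulInvariantVectorField ξ).of_le (by simp)
  obtain ⟨φ, hφ, hφ'⟩ := exists_isMIntegralCurveAt_of_contMDiffAt_boundaryless
    (t₀ := (0 : ℝ)) (hv.contMDiffAt (x := (1 : G)))
  rw [isMIntegralCurveAt_iff'] at hφ'
  obtain ⟨ε, hε, hφ'⟩ := hφ'
  rw [Real.ball_eq_Ioo, zero_sub, zero_add] at hφ'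
  refine exists_isMIntegralCurve_of_isMIntegralCurveOn hv hε
    (fun a => ⟨fun t => a * φ t, by simp [hφ], fun t ht => ?_⟩) 1
  have hd : HasMFDerivAt 𝓘(ℝ, F) 𝓘(ℝ, F) (fun h : G => a * h) (φ t) _ :=
    ((contMDiff_mul_left (I := 𝓘(ℝ, F)) (n := ∞) (a := a)).contMDiffAt.mdifferentiableAt
      (by simp)).hasMFDerivAt
  have := hd.comp_hasMFDerivWithinAt t (hφ' t ht)
  convert! this using 1
  rw [iff_iff_eq]
  congr 1
  refine ContinuousLinearMap.ext fun r : ℝ => ?_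
  have h3 := congrArg (fun v : F => r • v) (mulInvariantVectorField_mul ξ a (φ t))
  exact h3.symm.trans (ContinuousLinearMap.map_smul
    (mfderiv 𝓘(ℝ, F) 𝓘(ℝ, F) (fun h : G => a * h) (φ t)) r _).symm

/-- The one-parameter subgroup `t ↦ e^{tξ}` of a Lie group: the integral curve, through the
identity, of the left-invariant vector field of `ξ`. -/
def lieExp (ξ : GroupLieAlgebra 𝓘(ℝ, F) G) : ℝ → G :=
  (exists_oneParameterSubgroup ξ).choose

/-- The vector field `X_ξ(x) = d/dt|_{t=0} e^{tξ} · x` of a Lie group action. (The derivative is a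
tangent vector at `e^{0ξ} · x = x`.) -/
def fundamentalField {E : Type*} [NormedAddCommGroup E] [NormedSpace ℝ E]
    {M : Type*} [TopologicalSpace M] [ChartedSpace E M] [MulAction G M]
    (ξ : GroupLieAlgebra 𝓘(ℝ, F) G) (x : M) : TangentSpace 𝓘(ℝ, E) x :=
  (mfderiv 𝓘(ℝ, ℝ) 𝓘(ℝ, E) (fun t : ℝ => lieExp ξ t • x) 0 (1 : ℝ) : E)

end LieGroupAction

section Warped

/-- The interval `(0, ∞)`, as an open submanifold of `ℝ`. -/
def positiveReals : TopologicalSpace.Opens ℝ := ⟨Ioi 0, isOpen_Ioi⟩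

variable {E : Type*} [NormedAddCommGroup E] [NormedSpace ℝ E]
  {M : Type*} [TopologicalSpace M] [ChartedSpace E M] [IsManifold 𝓘(ℝ, E) ∞ M]

/-- The metric tensor of a smooth Riemannian metric. -/
def metricTensor (g : Bundle.ContMDiffRiemannianMetric 𝓘(ℝ, E) ∞ E
      (fun x : M => TangentSpace 𝓘(ℝ, E) x))
    (x : M) (v w : TangentSpace 𝓘(ℝ, E) x) : ℝ :=
  g.inner x v w

/-- The warped metric `I₀(σ) dσ² + I₁(σ) ds²_M` on `M × (0, ∞)`. A tangent vector at `(x, σ)` is a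
pair of a tangent vector at `x` and a real number (its `dσ`). -/
def warpedMetric (g : Bundle.ContMDiffRiemannianMetric 𝓘(ℝ, E) ∞ E
      (fun x : M => TangentSpace 𝓘(ℝ, E) x)) (I₀ I₁ : ℝ → ℝ)
    (z : M × positiveReals)
    (v w : TangentSpace (𝓘(ℝ, E).prod 𝓘(ℝ, ℝ)) z) : ℝ :=
  I₀ z.2 * ((v : E × ℝ).2 * (w : E × ℝ).2)
    + I₁ z.2 * metricTensor g z.1 (v : E × ℝ).1 (w : E × ℝ).1

/-- The energy `I₀(σ) σ̇² + I₁(σ) ‖ẋ‖²` at the time `t`. -/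
def warpedEnergy (g : Bundle.ContMDiffRiemannianMetric 𝓘(ℝ, E) ∞ E
      (fun x : M => TangentSpace 𝓘(ℝ, E) x)) (I₀ I₁ : ℝ → ℝ)
    (x : ℝ → M) (σ : ℝ → positiveReals) (t : ℝ) : ℝ :=
  I₀ (σ t) * (deriv (fun s => (σ s : ℝ)) t) ^ 2
    + I₁ (σ t) * metricTensor g (x t) (curveVelocity 𝓘(ℝ, E) x t) (curveVelocity 𝓘(ℝ, E) x t)

/-- The moment `I₁(σ) ⟨ẋ, X⟩` at the time `t`, for a vector field `X` on `M`. -/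
def warpedMoment (g : Bundle.ContMDiffRiemannianMetric 𝓘(ℝ, E) ∞ E
      (fun x : M => TangentSpace 𝓘(ℝ, E) x)) (I₁ : ℝ → ℝ)
    (x : ℝ → M) (σ : ℝ → positiveReals) (X : ∀ p : M, TangentSpace 𝓘(ℝ, E) p) (t : ℝ) : ℝ :=
  I₁ (σ t) * metricTensor g (x t) (curveVelocity 𝓘(ℝ, E) x t) (X (x t))

/-- The potential `V(s) = J₀ I₁(σ(0)) / I₁(s)` with `J₀ = I₁(σ(0)) ‖ẋ(0)‖²`. -/
def warpedPotential (g : Bundle.ContMDiffRiemannianMetric 𝓘(ℝ, E) ∞ E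
      (fun x : M => TangentSpace 𝓘(ℝ, E) x)) (I₁ : ℝ → ℝ)
    (x : ℝ → M) (σ : ℝ → positiveReals) (s : ℝ) : ℝ :=
  (I₁ (σ 0) *
      metricTensor g (x 0) (curveVelocity 𝓘(ℝ, E) x 0) (curveVelocity 𝓘(ℝ, E) x 0))
    * (I₁ (σ 0) / I₁ s)

end Warped

end

/-! In the product of a chart of `M` and the inclusion of (0, ∞), the warped metric reads I₀(σ)dσ² +
I₁(σ)B_u, where B_u is `chartMetric`. Testing its geodesic equation on vectors (w, 0) and (0, 1)
splits it into ∇_ẋ ẋ = -(I₁'(σ)σ̇ / I₁(σ)) ẋ (`IsWarpedGeodesic.equation_base`) and 2I₀σ̈ + I₀'σ̇² =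
I₁'‖ẋ‖² (`IsWarpedGeodesic.equation_coe`).

Conservation laws: pairing the first equation with ẋ shows that I₁(σ)²‖ẋ‖² is constant, so the part
I₁‖ẋ‖² of the energy is V(σ); together with the second equation this conserves E. Pairing the first
equation with X_ξ reduces the derivative of the moment to an expression that vanishes by Killing's
equation, which is the derivative at the identity of the invariance of the metric under G.

The curve x: its acceleration is proportional to its velocity, so x is a geodesic of M up to
parameter. A change of time with r' proportional to I₁(σ∘r) removes the acceleration
(`IsWarpedGeodesic.isGeodesicOn_comp`). Such an r is the inverse of τ(t) = ∫₀ᵗ I₁(σ(0))/I₁(σ),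
rescaled so that time t is reached at parameter 1. Uniqueness of geodesics (`IsGeodesicOn.eqOn`)
then identifies the endpoint with the value of Exp.

The curve σ: since E - V = I₀σ̇², the integrand of the quadrature is 1/|σ̇| wherever σ̇ ≠ 0, and the
time formula is a change of variables. -/

noncomputable section

/-! ### Metrics and velocities in a chart. -/

section ChartMetric

variable {E : Type*} [NormedAddCommGroup E] [NormedSpace ℝ E]
  {M : Type*} [TopologicalSpace M]

theorem extend_source_eq (e : OpenPartialHomeomorph M E) :
    (e.extend 𝓘(ℝ, E)).source = e.source := e.extend_source

theorem extend_target_eq (e : OpenPartialHomeomorph M E) :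
    (e.extend 𝓘(ℝ, E)).target = e.target := by
  simp

variable [ChartedSpace E M]

/-- The differential of the inverse of a chart. -/
def chartFrame (e : OpenPartialHomeomorph M E) (u : E) : E →L[ℝ] E :=
  mfderiv 𝓘(ℝ, E) 𝓘(ℝ, E) (e.extend 𝓘(ℝ, E)).symm u

variable [IsManifold 𝓘(ℝ, E) ∞ M]

theorem contMDiffAt_extend_symm {e : OpenPartialHomeomorph M E} (he : e ∈ atlas E M) {u : E}
    (hu : u ∈ e.target) : ContMDiffAt 𝓘(ℝ, E) 𝓘(ℝ, E) ∞ (e.extend 𝓘(ℝ, E)).symm u :=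
  contMDiffAt_symm_of_mem_maximalAtlas (IsManifold.subset_maximalAtlas he) hu

theorem contMDiffAt_extend {e : OpenPartialHomeomorph M E} (he : e ∈ atlas E M) {p : M}
    (hp : p ∈ e.source) : ContMDiffAt 𝓘(ℝ, E) 𝓘(ℝ, E) ∞ (e.extend 𝓘(ℝ, E)) p :=
  contMDiffAt_of_mem_maximalAtlas (IsManifold.subset_maximalAtlas he) hp

theorem mdifferentiableAt_extend_symm {e : OpenPartialHomeomorph M E} (he : e ∈ atlas E M) {u : E}
    (hu : u ∈ e.target) : MDifferentiableAt 𝓘(ℝ, E) 𝓘(ℝ, E) (e.extend 𝓘(ℝ, E)).symm u :=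
  (contMDiffAt_extend_symm he hu).mdifferentiableAt (by simp)

/-- A metric tensor, read in a chart, as a field of continuous bilinear forms. -/
def chartMetric (g : Bundle.ContMDiffRiemannianMetric 𝓘(ℝ, E) ∞ E
      (fun x : M => TangentSpace 𝓘(ℝ, E) x)) (e : OpenPartialHomeomorph M E) (u : E) :
    E →L[ℝ] E →L[ℝ] ℝ :=
  let B : E →L[ℝ] E →L[ℝ] ℝ := g.inner ((e.extend 𝓘(ℝ, E)).symm u)
  B.bilinearComp (chartFrame e u) (chartFrame e u)

variable (g : Bundle.ContMDiffRiemannianMetric 𝓘(ℝ, E) ∞ E (fun x : M => TangentSpace 𝓘(ℝ, E) x))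

theorem metricInChart_eq_chartMetric (e : OpenPartialHomeomorph M E) (u a b : E) :
    metricInChart 𝓘(ℝ, E) (metricTensor g) e u a b = chartMetric g e u a b := rfl

/-- A coordinate vector field is the tangent map of the inverse chart applied to a constant field,
hence smooth; pairing two of them with the smooth section g is smooth. -/
theorem contDiffOn_metricInChart {e : OpenPartialHomeomorph M E} (he : e ∈ atlas E M) (a b : E) :
    ContDiffOn ℝ ∞ (fun u => metricInChart 𝓘(ℝ, E) (metricTensor g) e u a b) e.target := by
  have hs : ContMDiffOn 𝓘(ℝ, E) 𝓘(ℝ, E) ∞ (e.extend 𝓘(ℝ, E)).symm e.target :=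
    fun u hu => (contMDiffAt_extend_symm he hu).contMDiffWithinAt
  have hv : ∀ a : E, ContMDiffOn 𝓘(ℝ, E) (𝓘(ℝ, E).prod 𝓘(ℝ, E)) ∞
      (fun u : E => (⟨(e.extend 𝓘(ℝ, E)).symm u,
        mfderiv 𝓘(ℝ, E) 𝓘(ℝ, E) (e.extend 𝓘(ℝ, E)).symm u a⟩ : TangentBundle 𝓘(ℝ, E) M))
      e.target := by
    intro a u hu
    have h1 := ((hs.contMDiffOn_tangentMapWithin (m := ∞) (by simp)
      e.open_target.uniqueMDiffOn) (⟨u, a⟩ : TangentBundle 𝓘(ℝ, E) E) hu)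
    have h2 : ContMDiffAt 𝓘(ℝ, E) (𝓘(ℝ, E).prod 𝓘(ℝ, E)) ∞
        (fun u : E => (⟨u, a⟩ : TangentBundle 𝓘(ℝ, E) E)) u := by
      rw [Bundle.contMDiffAt_totalSpace]
      refine ⟨contMDiffAt_id, ?_⟩
      simpa using contMDiffAt_const
    have h3 := h1.comp u h2.contMDiffWithinAt (s := e.target) (fun y hy => hy)
    refine h3.congr_of_mem (fun y hy => ?_) hu
    simp only [Function.comp, tangentMapWithin]
    rw [mfderivWithin_of_isOpen e.open_target hy]
  intro u hu
  have : ContMDiffWithinAt 𝓘(ℝ, E) (𝓘(ℝ, E).prod 𝓘(ℝ, ℝ)) ∞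
      (fun u => Bundle.TotalSpace.mk' ℝ (E := Bundle.Trivial M ℝ) ((e.extend 𝓘(ℝ, E)).symm u)
        (metricInChart 𝓘(ℝ, E) (metricTensor g) e u a b)) e.target u := by
    apply ContMDiffWithinAt.clm_bundle_apply₂ (F₁ := E) (F₂ := E)
    · exact ContMDiffAt.comp_contMDiffWithinAt u g.contMDiff.contMDiffAt (hs u hu)
    · exact hv a u hu
    · exact hv b u hu
  rw [Bundle.contMDiffWithinAt_totalSpace] at this
  exact contMDiffWithinAt_iff_contDiffWithinAt.1 this.2

/-- In finite dimension, smoothness of an operator-valued map can be tested vector by vector. -/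
theorem contDiffOn_chartMetric [FiniteDimensional ℝ E] {e : OpenPartialHomeomorph M E}
    (he : e ∈ atlas E M) : ContDiffOn ℝ ∞ (chartMetric g e) e.target :=
  contDiffOn_clm_apply.2 fun a => contDiffOn_clm_apply.2 fun b =>
    (contDiffOn_metricInChart g he a b).congr fun _ _ => rfl

theorem contDiffAt_chartMetric [FiniteDimensional ℝ E] {e : OpenPartialHomeomorph M E}
    (he : e ∈ atlas E M) {u : E} (hu : u ∈ e.target) : ContDiffAt ℝ ∞ (chartMetric g e) u :=
  (contDiffOn_chartMetric g he).contDiffAt (e.open_target.mem_nhds hu)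

theorem metricTensor_comm (p : M) (v w : TangentSpace 𝓘(ℝ, E) p) :
    metricTensor g p v w = metricTensor g p w v :=
  g.symm p v w

theorem metricTensor_pos (p : M) {v : TangentSpace 𝓘(ℝ, E) p} (hv : v ≠ 0) :
    0 < metricTensor g p v v :=
  g.pos p v hv

theorem chartMetric_apply (e : OpenPartialHomeomorph M E) (u a b : E) :
    chartMetric g e u a b = metricTensor g ((e.extend 𝓘(ℝ, E)).symm u)
      (chartFrame e u a : E) (chartFrame e u b : E) := rfl

theorem chartMetric_symm (e : OpenPartialHomeomorph M E) (u a b : E) :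
    chartMetric g e u a b = chartMetric g e u b a := by
  rw [chartMetric_apply, chartMetric_apply]
  exact metricTensor_comm g _ _ _

theorem hasMFDerivAt_extend_symm {e : OpenPartialHomeomorph M E} (he : e ∈ atlas E M) {u : E}
    (hu : u ∈ e.target) :
    HasMFDerivAt 𝓘(ℝ, E) 𝓘(ℝ, E) (e.extend 𝓘(ℝ, E)).symm u (chartFrame (E := E) e u) :=
  (mdifferentiableAt_extend_symm he hu).hasMFDerivAt

/-- The differential of the chart is a left inverse. This yields definiteness of `chartMetric`, and
lets coordinate velocities be recovered from velocities. -/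
theorem chartFrame_injective {e : OpenPartialHomeomorph M E} (he : e ∈ atlas E M) {u : E}
    (hu : u ∈ e.target) : Function.Injective (chartFrame e u) := by
  have hp : (e.extend 𝓘(ℝ, E)).symm u ∈ e.source := by
    simpa using e.map_target hu
  have h1 := ((contMDiffAt_extend he hp).mdifferentiableAt (by simp)).hasMFDerivAt.comp u
    (hasMFDerivAt_extend_symm he hu)
  have h2 : HasMFDerivAt 𝓘(ℝ, E) 𝓘(ℝ, E) (e.extend 𝓘(ℝ, E) ∘ (e.extend 𝓘(ℝ, E)).symm) u
      (ContinuousLinearMap.id ℝ E) := by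
    refine (hasMFDerivAt_id (I := 𝓘(ℝ, E)) u).congr_of_eventuallyEq ?_
    filter_upwards [e.open_target.mem_nhds hu] with y hy
    exact (e.extend 𝓘(ℝ, E)).right_inv (by rwa [extend_target_eq])
  let A : E →L[ℝ] E := mfderiv 𝓘(ℝ, E) 𝓘(ℝ, E) (e.extend 𝓘(ℝ, E)) ((e.extend 𝓘(ℝ, E)).symm u)
  have h3 : ∀ a, A (chartFrame e u a) = a := fun a =>
    congrArg (fun D : E →L[ℝ] E => D a) (hasMFDerivAt_unique h1 h2)
  exact Function.LeftInverse.injective h3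

theorem chartMetric_pos {e : OpenPartialHomeomorph M E} (he : e ∈ atlas E M) {u : E}
    (hu : u ∈ e.target) {a : E} (ha : a ≠ 0) : 0 < chartMetric g e u a a := by
  rw [chartMetric_apply]
  exact metricTensor_pos g _ fun h => ha (chartFrame_injective he hu (h.trans (map_zero (chartFrame e u)).symm))

theorem metricTensor_congr {p q : M} (h : p = q) (v w : E) :
    metricTensor g p v w = metricTensor g q v w := by
  subst h; rfl

theorem metricTensor_chartFrame {e : OpenPartialHomeomorph M E} {p : M} (hp : p ∈ e.source)
    (a b : E) :
    metricTensor g p (chartFrame e (e.extend 𝓘(ℝ, E) p) a : E)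
      (chartFrame e (e.extend 𝓘(ℝ, E) p) b : E) = chartMetric g e (e.extend 𝓘(ℝ, E) p) a b := by
  rw [chartMetric_apply]
  exact metricTensor_congr g ((e.extend 𝓘(ℝ, E)).left_inv (by rwa [extend_source_eq])).symm _ _

variable {c : ℝ → M} {t : ℝ}

theorem contDiffAt_extend_comp {e : OpenPartialHomeomorph M E} (he : e ∈ atlas E M)
    (hc : ContMDiffAt 𝓘(ℝ, ℝ) 𝓘(ℝ, E) ∞ c t) (ht : c t ∈ e.source) :
    ContDiffAt ℝ ∞ (fun s => e.extend 𝓘(ℝ, E) (c s)) t :=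
  contMDiffAt_iff_contDiffAt.1 ((contMDiffAt_extend he ht).comp t hc)

/-- The velocity of a curve, read in a chart. -/
theorem mfderiv_curve_eq {e : OpenPartialHomeomorph M E} (he : e ∈ atlas E M)
    (hc : MDifferentiableAt 𝓘(ℝ, ℝ) 𝓘(ℝ, E) c t) (ht : c t ∈ e.source) :
    (mfderiv 𝓘(ℝ, ℝ) 𝓘(ℝ, E) c t (1 : ℝ) : E)
      = chartFrame e (e.extend 𝓘(ℝ, E) (c t)) (deriv (fun s => e.extend 𝓘(ℝ, E) (c s)) t) := by
  have hd : DifferentiableAt ℝ (fun s => e.extend 𝓘(ℝ, E) (c s)) t :=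
    mdifferentiableAt_iff_differentiableAt.1
      (((contMDiffAt_extend he ht).mdifferentiableAt (by simp)).comp t hc)
  have hut : e.extend 𝓘(ℝ, E) (c t) ∈ e.target := by simpa using e.map_source ht
  have h1 : HasMFDerivAt 𝓘(ℝ, ℝ) 𝓘(ℝ, E)
      ((e.extend 𝓘(ℝ, E)).symm ∘ fun s => e.extend 𝓘(ℝ, E) (c s)) t _ :=
    (hasMFDerivAt_extend_symm he hut).comp t hd.hasFDerivAt.hasMFDerivAt
  have h2 : c =ᶠ[𝓝 t] ((e.extend 𝓘(ℝ, E)).symm ∘ fun s => e.extend 𝓘(ℝ, E) (c s)) := by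
    filter_upwards [hc.continuousAt.preimage_mem_nhds (e.open_source.mem_nhds ht)] with s hs
    exact ((e.extend 𝓘(ℝ, E)).left_inv (by rwa [extend_source_eq])).symm
  have h3 := congrArg (fun D : ℝ →L[ℝ] E => D 1) (h1.congr_of_eventuallyEq h2).mfderiv
  have h4 : fderiv ℝ (fun s => e.extend 𝓘(ℝ, E) (c s)) t (1 : ℝ)
      = deriv (fun s => e.extend 𝓘(ℝ, E) (c s)) t := fderiv_apply_one_eq_deriv
  exact h3.trans (congrArg (chartFrame e (e.extend 𝓘(ℝ, E) (c t))) h4)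

theorem metricTensor_curveVelocity {e : OpenPartialHomeomorph M E} (he : e ∈ atlas E M)
    (hc : MDifferentiableAt 𝓘(ℝ, ℝ) 𝓘(ℝ, E) c t) (ht : c t ∈ e.source) :
    metricTensor g (c t) (curveVelocity 𝓘(ℝ, E) c t) (curveVelocity 𝓘(ℝ, E) c t)
      = chartMetric g e (e.extend 𝓘(ℝ, E) (c t)) (deriv (fun s => e.extend 𝓘(ℝ, E) (c s)) t)
        (deriv (fun s => e.extend 𝓘(ℝ, E) (c s)) t) := by
  rw [← metricTensor_chartFrame g ht]
  exact congrArg (fun v : E => metricTensor g (c t) v v) (mfderiv_curve_eq he hc ht)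

end ChartMetric

/-! ### The global chart of (0, ∞). -/

section PositiveReals

theorem positiveReals_chart_source (p : positiveReals) :
    (chartAt ℝ p).source = univ := by
  change ((chartAt ℝ (p : ℝ)).subtypeRestr ⟨p⟩).source = univ
  rw [OpenPartialHomeomorph.subtypeRestr_source]
  simp [chartAt_self_eq]

theorem positiveReals_mem_chart_target (p : positiveReals) {s : ℝ} (hs : 0 < s) :
    s ∈ (chartAt ℝ p).target := by
  let q : positiveReals := ⟨s, hs⟩
  have : q ∈ (chartAt ℝ p).source := by rw [positiveReals_chart_source]; trivial
  exact (chartAt ℝ p).map_source this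

theorem positiveReals_coe_chart_symm (p : positiveReals) {s : ℝ} (hs : 0 < s) :
    (((chartAt ℝ p).symm s : positiveReals) : ℝ) = s :=
  (chartAt ℝ p).right_inv (positiveReals_mem_chart_target p hs)

theorem positiveReals_hasMFDerivAt_chart_symm (p : positiveReals) {s : ℝ} (hs : 0 < s) :
    HasMFDerivAt 𝓘(ℝ, ℝ) 𝓘(ℝ, ℝ) (chartAt ℝ p).symm s (ContinuousLinearMap.id ℝ ℝ) := by
  refine ⟨(chartAt ℝ p).continuousAt_symm (positiveReals_mem_chart_target p hs), ?_⟩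
  -- Read in the chart of the target, which is the inclusion into ℝ, the inverse chart is the
  -- identity near `s`.
  have h : HasFDerivAt (fun r => (((chartAt ℝ p).symm r : positiveReals) : ℝ))
      (ContinuousLinearMap.id ℝ ℝ) s := by
    refine (hasFDerivAt_id s).congr_of_eventuallyEq ?_
    filter_upwards [lt_mem_nhds hs] with r hr
    exact positiveReals_coe_chart_symm p hr
  exact h.hasFDerivWithinAt

end PositiveReals

/-! ### Components and Christoffel symbols of the warped metric. -/

section WarpedChart

variable {E : Type*} [NormedAddCommGroup E] [NormedSpace ℝ E]
  {M : Type*} [TopologicalSpace M] [ChartedSpace E M] [IsManifold 𝓘(ℝ, E) ∞ M]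
  (g : Bundle.ContMDiffRiemannianMetric 𝓘(ℝ, E) ∞ E (fun x : M => TangentSpace 𝓘(ℝ, E) x))
  (I₀ I₁ : ℝ → ℝ)

theorem metricInChart_warpedMetric {e : OpenPartialHomeomorph M E} (he : e ∈ atlas E M)
    (p : positiveReals) {z : E × ℝ} (hu : z.1 ∈ e.target) (hs : 0 < z.2) (v w : E × ℝ) :
    metricInChart (𝓘(ℝ, E).prod 𝓘(ℝ, ℝ)) (warpedMetric g I₀ I₁) (e.prod (chartAt ℝ p)) z v w
      = I₀ z.2 * (v.2 * w.2) + I₁ z.2 * chartMetric g e z.1 v.1 w.1 := by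
  have h1 : HasMFDerivAt 𝓘(ℝ, E × ℝ) (𝓘(ℝ, E).prod 𝓘(ℝ, ℝ))
      ((e.prod (chartAt ℝ p)).extend (𝓘(ℝ, E).prod 𝓘(ℝ, ℝ))).symm z
      ((chartFrame (E := E) e z.1).prodMap (ContinuousLinearMap.id ℝ ℝ)) := by
    rw [modelWithCornersSelf_prod, ← chartedSpaceSelf_prod]
    have h := HasMFDerivAt.prodMap (hasMFDerivAt_extend_symm he hu)
      (positiveReals_hasMFDerivAt_chart_symm p hs)
    rw [(positiveReals_hasMFDerivAt_chart_symm p hs).mfderiv] at h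
    exact h
  unfold metricInChart
  rw [h1.mfderiv]
  change I₀ (((chartAt ℝ p).symm z.2 : positiveReals) : ℝ) * (v.2 * w.2)
    + I₁ (((chartAt ℝ p).symm z.2 : positiveReals) : ℝ) * chartMetric g e z.1 v.1 w.1 = _
  rw [positiveReals_coe_chart_symm p hs]


/-- With both upper arguments equal, the first two terms of the symbol coincide. The geodesic
equation needs only this diagonal case. -/
theorem christoffelInChart_eq [FiniteDimensional ℝ E] {e : OpenPartialHomeomorph M E}
    (he : e ∈ atlas E M) {u : E} (hu : u ∈ e.target) (a w : E) :
    christoffelInChart 𝓘(ℝ, E) (metricTensor g) e u a a w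
      = (2 * fderiv ℝ (chartMetric g e) u a a w - fderiv ℝ (chartMetric g e) u w a a) / 2 := by
  have hd : HasFDerivAt (chartMetric g e) (fderiv ℝ (chartMetric g e) u) u :=
    ((contDiffAt_chartMetric g he hu).differentiableAt (by simp)).hasFDerivAt
  have h : ∀ b c : E, fderiv ℝ (fun u' => metricInChart 𝓘(ℝ, E) (metricTensor g) e u' b c) u
      = ((fderiv ℝ (chartMetric g e) u).flip b).flip c := by
    intro b c
    have := ((hd.clm_apply (hasFDerivAt_const b u)).clm_apply (hasFDerivAt_const c u)).fderiv
    refine this.trans ?_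
    ext v
    simp
  simp only [christoffelInChart, h, ContinuousLinearMap.flip_apply]
  ring

/-- Here `k` stands for the product of the two dσ-components, which is constant in the chart. -/
theorem fderiv_warped_apply [FiniteDimensional ℝ E] {e : OpenPartialHomeomorph M E}
    (he : e ∈ atlas E M) {z : E × ℝ} (hu : z.1 ∈ e.target)
    (h₀ : DifferentiableAt ℝ I₀ z.2) (h₁ : DifferentiableAt ℝ I₁ z.2) (k : ℝ) (a b : E) (d : E × ℝ) :
    fderiv ℝ (fun y : E × ℝ => I₀ y.2 * k + I₁ y.2 * chartMetric g e y.1 a b) z d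
      = deriv I₀ z.2 * d.2 * k + deriv I₁ z.2 * d.2 * chartMetric g e z.1 a b
        + I₁ z.2 * fderiv ℝ (chartMetric g e) z.1 d.1 a b := by
  have hd : HasFDerivAt (chartMetric g e) (fderiv ℝ (chartMetric g e) z.1) z.1 :=
    ((contDiffAt_chartMetric g he hu).differentiableAt (by simp)).hasFDerivAt
  have hB₀ : HasFDerivAt (fun y : E × ℝ => chartMetric g e y.1)
      ((fderiv ℝ (chartMetric g e) z.1).comp (ContinuousLinearMap.fst ℝ E ℝ)) z :=
    HasFDerivAt.comp (g := chartMetric g e) (g' := fderiv ℝ (chartMetric g e) z.1) (f := Prod.fst)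
      (f' := ContinuousLinearMap.fst ℝ E ℝ) z hd hasFDerivAt_fst
  have hB := (hB₀.clm_apply (hasFDerivAt_const a z)).clm_apply (hasFDerivAt_const b z)
  have hI₀ := h₀.hasDerivAt.comp_hasFDerivAt z
    (f := Prod.snd) (f' := ContinuousLinearMap.snd ℝ E ℝ) hasFDerivAt_snd
  have hI₁ := h₁.hasDerivAt.comp_hasFDerivAt z
    (f := Prod.snd) (f' := ContinuousLinearMap.snd ℝ E ℝ) hasFDerivAt_snd
  have := ((hI₀.mul_const k).add (hI₁.mul hB)).fderiv
  refine (congrArg (fun D : E × ℝ →L[ℝ] ℝ => D d) this).trans ?_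
  simp
  ring

theorem christoffelInChart_warpedMetric [FiniteDimensional ℝ E] {e : OpenPartialHomeomorph M E}
    (he : e ∈ atlas E M) (p : positiveReals) {z : E × ℝ} (hu : z.1 ∈ e.target) (hs : 0 < z.2)
    (h₀ : DifferentiableAt ℝ I₀ z.2) (h₁ : DifferentiableAt ℝ I₁ z.2) (v w : E × ℝ) :
    christoffelInChart (𝓘(ℝ, E).prod 𝓘(ℝ, ℝ)) (warpedMetric g I₀ I₁) (e.prod (chartAt ℝ p)) z v v w
      = (2 * (deriv I₀ z.2 * v.2 * (v.2 * w.2) + deriv I₁ z.2 * v.2 * chartMetric g e z.1 v.1 w.1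
          + I₁ z.2 * fderiv ℝ (chartMetric g e) z.1 v.1 v.1 w.1)
        - (deriv I₀ z.2 * w.2 * (v.2 * v.2) + deriv I₁ z.2 * w.2 * chartMetric g e z.1 v.1 v.1
          + I₁ z.2 * fderiv ℝ (chartMetric g e) z.1 w.1 v.1 v.1)) / 2 := by
  have h : ∀ b c : E × ℝ, (fun y => metricInChart (𝓘(ℝ, E).prod 𝓘(ℝ, ℝ)) (warpedMetric g I₀ I₁)
      (e.prod (chartAt ℝ p)) y b c) =ᶠ[𝓝 z]
      fun y : E × ℝ => I₀ y.2 * (b.2 * c.2) + I₁ y.2 * chartMetric g e y.1 b.1 c.1 := by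
    intro b c
    filter_upwards [continuousAt_fst.preimage_mem_nhds (e.open_target.mem_nhds hu),
      continuousAt_snd.preimage_mem_nhds (lt_mem_nhds hs)] with y hy1 hy2
    exact metricInChart_warpedMetric g I₀ I₁ he p hy1 hy2 b c
  unfold christoffelInChart
  rw [(h v w).fderiv_eq, (h v v).fderiv_eq, fderiv_warped_apply g I₀ I₁ he hu h₀ h₁,
    fderiv_warped_apply g I₀ I₁ he hu h₀ h₁]
  ring

end WarpedChart

/-! ### The geodesic equation of the warped metric in coordinates. -/

section WarpedGeodesic

variable {E : Type*} [NormedAddCommGroup E] [NormedSpace ℝ E]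
  {M : Type*} [TopologicalSpace M] [ChartedSpace E M] [IsManifold 𝓘(ℝ, E) ∞ M]

theorem eq_of_hasDerivAt_zero {f : ℝ → ℝ} {J : Set ℝ} (hJ_open : IsOpen J) (hJ_conn : J.OrdConnected)
    (h : ∀ t ∈ J, HasDerivAt f 0 t) {s t : ℝ} (hs : s ∈ J) (ht : t ∈ J) : f s = f t :=
  hJ_open.is_const_of_deriv_eq_zero hJ_conn.isPreconnected
    (fun r hr => (h r hr).differentiableAt.differentiableWithinAt) (fun r hr => (h r hr).deriv) hs ht

/-- `(x, σ)` is a geodesic, on the open set `J`, of the warped metric with the smooth positive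
coefficients `I₀` and `I₁`. -/
structure IsWarpedGeodesic
    (g : Bundle.ContMDiffRiemannianMetric 𝓘(ℝ, E) ∞ E (fun x : M => TangentSpace 𝓘(ℝ, E) x))
    (I₀ I₁ : ℝ → ℝ) (J : Set ℝ) (x : ℝ → M) (σ : ℝ → positiveReals) : Prop where
  smooth₀ : ContDiffOn ℝ ∞ I₀ (Ioi 0)
  smooth₁ : ContDiffOn ℝ ∞ I₁ (Ioi 0)
  pos₀ : ∀ s, 0 < s → 0 < I₀ s
  pos₁ : ∀ s, 0 < s → 0 < I₁ s
  isOpen : IsOpen J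
  ordConnected : J.OrdConnected
  isGeodesicOn :
    IsGeodesicOn (𝓘(ℝ, E).prod 𝓘(ℝ, ℝ)) (warpedMetric g I₀ I₁) (fun t => (x t, σ t)) J

variable {g : Bundle.ContMDiffRiemannianMetric 𝓘(ℝ, E) ∞ E (fun x : M => TangentSpace 𝓘(ℝ, E) x)}
  {I₀ I₁ : ℝ → ℝ} {J : Set ℝ} {x : ℝ → M} {σ : ℝ → positiveReals} {t : ℝ}

theorem IsWarpedGeodesic.contMDiffAt
    (h : IsWarpedGeodesic g I₀ I₁ J x σ) (ht : t ∈ J) : ContMDiffAt 𝓘(ℝ, ℝ) 𝓘(ℝ, E) ∞ x t :=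
  (h.isGeodesicOn.1.contMDiffAt (h.isOpen.mem_nhds ht)).fst

theorem IsWarpedGeodesic.contDiffAt
    (h : IsWarpedGeodesic g I₀ I₁ J x σ) (ht : t ∈ J) : ContDiffAt ℝ ∞ (fun s => (σ s : ℝ)) t :=
  contMDiffAt_iff_contDiffAt.1 ((contMDiff_subtype_val (I := 𝓘(ℝ, ℝ))
    (U := positiveReals)).contMDiffAt.comp t (h.isGeodesicOn.1.contMDiffAt (h.isOpen.mem_nhds ht)).snd)

theorem hasDerivAt_deriv_of_contDiffAt {F : Type*} [NormedAddCommGroup F] [NormedSpace ℝ F]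
    {f : ℝ → F} (hf : ContDiffAt ℝ ∞ f t) : HasDerivAt f (deriv f t) t :=
  (hf.differentiableAt (by simp)).hasDerivAt

theorem contDiffAt_deriv_of_contDiffAt {F : Type*} [NormedAddCommGroup F] [NormedSpace ℝ F]
    {f : ℝ → F} (hf : ContDiffAt ℝ ∞ f t) : ContDiffAt ℝ ∞ (deriv f) t := by
  have h := (hf.fderiv_right (m := ∞) (by simp)).clm_apply (contDiffAt_const (c := (1 : ℝ)))
  exact h.congr_of_eventuallyEq (Filter.Eventually.of_forall fun s =>
    fderiv_apply_one_eq_deriv.symm)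

variable [FiniteDimensional ℝ E]

variable (g) in
theorem hasDerivAt_chartMetric {e : OpenPartialHomeomorph M E} (he : e ∈ atlas E M) {u Y Z : ℝ → E}
    {u' Y' Z' : E} (hu : HasDerivAt u u' t) (hut : u t ∈ e.target) (hY : HasDerivAt Y Y' t)
    (hZ : HasDerivAt Z Z' t) :
    HasDerivAt (fun s => chartMetric g e (u s) (Y s) (Z s))
      (fderiv ℝ (chartMetric g e) (u t) u' (Y t) (Z t) + chartMetric g e (u t) Y' (Z t)
        + chartMetric g e (u t) (Y t) Z') t := by
  have hd : HasFDerivAt (chartMetric g e) (fderiv ℝ (chartMetric g e) (u t)) (u t) :=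
    ((contDiffAt_chartMetric g he hut).differentiableAt (by simp)).hasFDerivAt
  have hB : HasDerivAt (fun s => chartMetric g e (u s)) (fderiv ℝ (chartMetric g e) (u t) u') t :=
    HasFDerivAt.comp_hasDerivAt (l := chartMetric g e) (l' := fderiv ℝ (chartMetric g e) (u t)) t hd hu
  have h := (hB.clm_apply hY).clm_apply hZ
  simpa using h

theorem IsWarpedGeodesic.equation
    (h : IsWarpedGeodesic g I₀ I₁ J x σ) (ht : t ∈ J) {e : OpenPartialHomeomorph M E} (he : e ∈ atlas E M) (hx : x t ∈ e.source)
    {u : ℝ → E} (hu : u = fun s => e.extend 𝓘(ℝ, E) (x s))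
    {q : ℝ → ℝ} (hq : q = fun s => (σ s : ℝ)) (w : E) (ζ : ℝ) :
    I₀ (q t) * (deriv (deriv q) t * ζ) + I₁ (q t) * chartMetric g e (u t) (deriv (deriv u) t) w
      + (2 * (deriv I₀ (q t) * deriv q t * (deriv q t * ζ)
          + deriv I₁ (q t) * deriv q t * chartMetric g e (u t) (deriv u t) w
          + I₁ (q t) * fderiv ℝ (chartMetric g e) (u t) (deriv u t) (deriv u t) w)
        - (deriv I₀ (q t) * ζ * (deriv q t * deriv q t)
          + deriv I₁ (q t) * ζ * chartMetric g e (u t) (deriv u t) (deriv u t)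
          + I₁ (q t) * fderiv ℝ (chartMetric g e) (u t) w (deriv u t) (deriv u t))) / 2 = 0 := by
  have hx_cont := (h.contMDiffAt ht).continuousAt
  have hnear : ∀ᶠ s in 𝓝 t, s ∈ J ∧ x s ∈ e.source :=
    (h.isOpen.eventually_mem ht).and (hx_cont.preimage_mem_nhds (e.open_source.mem_nhds hx))
  have hus : ∀ s, s ∈ J → x s ∈ e.source → ContDiffAt ℝ ∞ u s := fun s hs hxs => by
    rw [hu]; exact contDiffAt_extend_comp he (h.contMDiffAt hs) hxs
  have hqs : ∀ s, s ∈ J → ContDiffAt ℝ ∞ q s := fun s hs => by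
    rw [hq]; exact h.contDiffAt hs
  -- The splitting of the velocity is needed on a neighbourhood of `t`, because it is differentiated
  -- once more.
  have hd : deriv (fun s => (u s, q s)) =ᶠ[𝓝 t] fun s => (deriv u s, deriv q s) := by
    filter_upwards [hnear] with s hs
    exact ((hasDerivAt_deriv_of_contDiffAt (hus s hs.1 hs.2)).prodMk
      (hasDerivAt_deriv_of_contDiffAt (hqs s hs.1))).deriv
  have hdd : deriv (deriv (fun s => (u s, q s))) t = (deriv (deriv u) t, deriv (deriv q) t) := by
    rw [hd.deriv_eq]
    exact ((hasDerivAt_deriv_of_contDiffAt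
      (contDiffAt_deriv_of_contDiffAt (hus t ht hx))).prodMk
      (hasDerivAt_deriv_of_contDiffAt (contDiffAt_deriv_of_contDiffAt (hqs t ht)))).deriv
  have hut : u t ∈ e.target := by rw [hu]; simpa using e.map_source hx
  have hqt : 0 < q t := by rw [hq]; exact (σ t).2
  have hmem : e.prod (chartAt ℝ (σ t)) ∈ atlas (ModelProd E ℝ) (M × positiveReals) :=
    Set.mem_image2_of_mem he (chart_mem_atlas ℝ (σ t))
  have hsrc : (x t, σ t) ∈ (e.prod (chartAt ℝ (σ t))).source := ⟨hx, mem_chart_source ℝ (σ t)⟩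
  have heq := h.isGeodesicOn.2 t ht (e.prod (chartAt ℝ (σ t))) hmem hsrc (w, ζ)
  have hcurve : (fun s => (e.prod (chartAt ℝ (σ t))).extend (𝓘(ℝ, E).prod 𝓘(ℝ, ℝ)) (x s, σ s))
      = fun s => (u s, q s) := by subst hu hq; rfl
  have hpt : (e.prod (chartAt ℝ (σ t))).extend (𝓘(ℝ, E).prod 𝓘(ℝ, ℝ)) (x t, σ t)
      = (u t, q t) := congrFun hcurve t
  rw [hcurve, hpt, hdd, hd.self_of_nhds, metricInChart_warpedMetric g I₀ I₁ he (σ t) hut hqt,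
    christoffelInChart_warpedMetric g I₀ I₁ he (σ t) hut hqt
      ((h.smooth₀.contDiffAt (Ioi_mem_nhds hqt)).differentiableAt (by simp))
      ((h.smooth₁.contDiffAt (Ioi_mem_nhds hqt)).differentiableAt (by simp))] at heq
  exact heq

end WarpedGeodesic

/-! ### The two components of the equation and conservation of energy. -/

section Conservation

variable {E : Type*} [NormedAddCommGroup E] [NormedSpace ℝ E]
  {M : Type*} [TopologicalSpace M] [ChartedSpace E M] [IsManifold 𝓘(ℝ, E) ∞ M]
  {g : Bundle.ContMDiffRiemannianMetric 𝓘(ℝ, E) ∞ E (fun x : M => TangentSpace 𝓘(ℝ, E) x)}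
  {I₀ I₁ : ℝ → ℝ} {J : Set ℝ} {x : ℝ → M} {σ : ℝ → positiveReals} {t : ℝ}

variable (g) in
/-- The square of the speed of a curve. -/
def speedSq (c : ℝ → M) (t : ℝ) : ℝ :=
  metricTensor g (c t) (curveVelocity 𝓘(ℝ, E) c t) (curveVelocity 𝓘(ℝ, E) c t)

theorem IsWarpedGeodesic.hasDerivAt_coe (h : IsWarpedGeodesic g I₀ I₁ J x σ) (ht : t ∈ J) :
    HasDerivAt (fun s => (σ s : ℝ)) (deriv (fun s => (σ s : ℝ)) t) t :=
  hasDerivAt_deriv_of_contDiffAt (h.contDiffAt ht)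

theorem IsWarpedGeodesic.hasDerivAt_coeff₀ (h : IsWarpedGeodesic g I₀ I₁ J x σ) (ht : t ∈ J) :
    HasDerivAt (fun s => I₀ (σ s)) (deriv I₀ (σ t) * deriv (fun s => (σ s : ℝ)) t) t :=
  ((h.smooth₀.contDiffAt (Ioi_mem_nhds (σ t).2)).differentiableAt (by simp)).hasDerivAt.comp t
    (h.hasDerivAt_coe ht)

theorem IsWarpedGeodesic.hasDerivAt_coeff₁ (h : IsWarpedGeodesic g I₀ I₁ J x σ) (ht : t ∈ J) :
    HasDerivAt (fun s => I₁ (σ s)) (deriv I₁ (σ t) * deriv (fun s => (σ s : ℝ)) t) t :=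
  ((h.smooth₁.contDiffAt (Ioi_mem_nhds (σ t).2)).differentiableAt (by simp)).hasDerivAt.comp t
    (h.hasDerivAt_coe ht)

theorem IsWarpedGeodesic.eventually_mem_source (h : IsWarpedGeodesic g I₀ I₁ J x σ) (ht : t ∈ J)
    {e : OpenPartialHomeomorph M E} (hx : x t ∈ e.source) :
    ∀ᶠ s in 𝓝 t, s ∈ J ∧ x s ∈ e.source :=
  (h.isOpen.eventually_mem ht).and
    ((h.contMDiffAt ht).continuousAt.preimage_mem_nhds (e.open_source.mem_nhds hx))

variable [FiniteDimensional ℝ E]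

/-- The component along `M` of the geodesic equation of a warped metric. -/
theorem IsWarpedGeodesic.equation_base (h : IsWarpedGeodesic g I₀ I₁ J x σ) (ht : t ∈ J)
    {e : OpenPartialHomeomorph M E} (he : e ∈ atlas E M) (hx : x t ∈ e.source)
    {u : ℝ → E} (hu : u = fun s => e.extend 𝓘(ℝ, E) (x s)) (w : E) :
    chartMetric g e (u t) (deriv (deriv u) t) w
      + (2 * fderiv ℝ (chartMetric g e) (u t) (deriv u t) (deriv u t) w
        - fderiv ℝ (chartMetric g e) (u t) w (deriv u t) (deriv u t)) / 2
      = -(deriv I₁ (σ t) * deriv (fun s => (σ s : ℝ)) t / I₁ (σ t))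
        * chartMetric g e (u t) (deriv u t) w := by
  have h1 := h.equation ht he hx hu rfl w 0
  have h2 : I₁ (σ t) ≠ 0 := (h.pos₁ _ (σ t).2).ne'
  field_simp
  linear_combination 2 * h1

theorem IsWarpedGeodesic.hasDerivAt_speedSq (h : IsWarpedGeodesic g I₀ I₁ J x σ) (ht : t ∈ J) :
    HasDerivAt (speedSq g x)
      (-(2 * (deriv I₁ (σ t) * deriv (fun s => (σ s : ℝ)) t / I₁ (σ t))) * speedSq g x t) t := by
  have he := chart_mem_atlas E (x t)
  have hx := mem_chart_source E (x t)
  set e := chartAt E (x t)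
  obtain ⟨u, hu⟩ : ∃ u : ℝ → E, u = fun s => e.extend 𝓘(ℝ, E) (x s) := ⟨_, rfl⟩
  have hus : ContDiffAt ℝ ∞ u t := by rw [hu]; exact contDiffAt_extend_comp he (h.contMDiffAt ht) hx
  have hut : u t ∈ e.target := by rw [hu]; simpa using e.map_source hx
  have hS : ∀ s, s ∈ J → x s ∈ e.source →
      speedSq g x s = chartMetric g e (u s) (deriv u s) (deriv u s) := fun s hs hxs => by
    rw [hu]
    exact metricTensor_curveVelocity g he ((h.contMDiffAt hs).mdifferentiableAt (by simp)) hxs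
  have hu' := hasDerivAt_deriv_of_contDiffAt (contDiffAt_deriv_of_contDiffAt hus)
  have hd := hasDerivAt_chartMetric g he (hasDerivAt_deriv_of_contDiffAt hus) hut hu' hu'
  have hev : speedSq g x =ᶠ[𝓝 t] fun s => chartMetric g e (u s) (deriv u s) (deriv u s) :=
    (h.eventually_mem_source ht hx).mono fun s hs => hS s hs.1 hs.2
  refine (hd.congr_of_eventuallyEq hev).congr_deriv ?_
  -- For w = u̇ the Christoffel term is half of (∂_u̇ B)(u̇, u̇), so twice this equation is the
  -- product-rule expression for the derivative of B(u̇, u̇).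
  have h1 := h.equation_base ht he hx hu (deriv u t)
  have h2 := chartMetric_symm g e (u t) (deriv u t) (deriv (deriv u) t)
  rw [hS t ht hx]
  linear_combination 2 * h1 + h2

/-- The component along `(0, ∞)` of the geodesic equation of a warped metric. -/
theorem IsWarpedGeodesic.equation_coe (h : IsWarpedGeodesic g I₀ I₁ J x σ) (ht : t ∈ J) :
    2 * (I₀ (σ t) * deriv (deriv fun s => (σ s : ℝ)) t)
      + deriv I₀ (σ t) * deriv (fun s => (σ s : ℝ)) t ^ 2
      - deriv I₁ (σ t) * speedSq g x t = 0 := by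
  have he := chart_mem_atlas E (x t)
  have hx := mem_chart_source E (x t)
  have h1 := h.equation ht he hx rfl rfl 0 1
  have h2 : speedSq g x t = _ :=
    metricTensor_curveVelocity g he ((h.contMDiffAt ht).mdifferentiableAt (by simp)) hx
  rw [h2]
  simp only [map_zero, zero_apply] at h1
  linear_combination 2 * h1

/-- The logarithmic derivative of I₁² cancels the damping factor -2I₁'σ̇/I₁ of the squared speed. -/
theorem IsWarpedGeodesic.sq_mul_speedSq_eq (h : IsWarpedGeodesic g I₀ I₁ J x σ) {s : ℝ}
    (hs : s ∈ J) (ht : t ∈ J) :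
    I₁ (σ s) ^ 2 * speedSq g x s = I₁ (σ t) ^ 2 * speedSq g x t := by
  refine eq_of_hasDerivAt_zero (f := fun s => I₁ (σ s) ^ 2 * speedSq g x s) h.isOpen h.ordConnected
    (fun r hr => ?_) hs ht
  refine (((h.hasDerivAt_coeff₁ hr).pow 2).mul (h.hasDerivAt_speedSq hr)).congr_deriv ?_
  have h2 : I₁ (σ r) ≠ 0 := (h.pos₁ _ (σ r).2).ne'
  simp only [Pi.pow_apply]
  field_simp
  ring

/-- After substitution of the derivative of the squared speed, Ė is σ̇ times the σ-component of the
geodesic equation. -/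
theorem IsWarpedGeodesic.energy_eq (h : IsWarpedGeodesic g I₀ I₁ J x σ) {s : ℝ}
    (hs : s ∈ J) (ht : t ∈ J) : warpedEnergy g I₀ I₁ x σ s = warpedEnergy g I₀ I₁ x σ t := by
  refine eq_of_hasDerivAt_zero h.isOpen h.ordConnected (fun r hr => ?_) hs ht
  have hq := hasDerivAt_deriv_of_contDiffAt (contDiffAt_deriv_of_contDiffAt (h.contDiffAt hr))
  refine (((h.hasDerivAt_coeff₀ hr).mul (hq.pow 2)).add
    ((h.hasDerivAt_coeff₁ hr).mul (h.hasDerivAt_speedSq hr))).congr_deriv ?_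
  have h2 : I₁ (σ r) ≠ 0 := (h.pos₁ _ (σ r).2).ne'
  have h1 := h.equation_coe hr
  simp only [Pi.pow_apply]
  field_simp
  linear_combination deriv (fun s => (σ s : ℝ)) r * h1

/-- Constancy of I₁²‖ẋ‖² turns the term I₁‖ẋ‖² of the energy into V(σ). -/
theorem IsWarpedGeodesic.energy_sub_potential (h : IsWarpedGeodesic g I₀ I₁ J x σ) (h0 : 0 ∈ J)
    (ht : t ∈ J) : I₀ (σ t) * (deriv (fun s => (σ s : ℝ)) t) ^ 2
      = warpedEnergy g I₀ I₁ x σ 0 - warpedPotential g I₁ x σ (σ t) := by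
  have h1 : warpedEnergy g I₀ I₁ x σ t
    = I₀ (σ t) * (deriv (fun s => (σ s : ℝ)) t) ^ 2 + I₁ (σ t) * speedSq g x t := rfl
  have h2 : warpedPotential g I₁ x σ (σ t)
    = I₁ (σ 0) * speedSq g x 0 * (I₁ (σ 0) / I₁ (σ t)) := rfl
  have h3 := h.sq_mul_speedSq_eq h0 ht
  have h4 : I₁ (σ t) ≠ 0 := (h.pos₁ _ (σ t).2).ne'
  rw [h.energy_eq h0 ht, h1, h2]
  field_simp
  linear_combination h3

end Conservation

/-! ### Killing's equation for a local family of isometries. -/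

section Killing

variable {E : Type*} [NormedAddCommGroup E] [NormedSpace ℝ E]
  {F : Type*} [NormedAddCommGroup F] [NormedSpace ℝ F]

/-- The infinitesimal form of the invariance of a field `B` of symmetric bilinear forms under a
family `P (k, ·)` of maps with `P (k₀, ·) = id`. -/
theorem killing_equation {B : E → E →L[ℝ] E →L[ℝ] ℝ} {P : F × E → E} {k₀ : F} {u₀ : E} (η : F) (a : E)
    (hB : DifferentiableAt ℝ B u₀) (hsymm : ∀ v w, B u₀ v w = B u₀ w v)
    (hP : ContDiffAt ℝ ∞ P (k₀, u₀)) (hP_id : ∀ᶠ u in 𝓝 u₀, P (k₀, u) = u)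
    (hP_iso : ∀ᶠ k in 𝓝 k₀, B (P (k, u₀)) (fderiv ℝ P (k, u₀) (0, a))
      (fderiv ℝ P (k, u₀) (0, a)) = B u₀ a a) :
    DifferentiableAt ℝ (fun u => fderiv ℝ P (k₀, u) (η, 0)) u₀ ∧
    fderiv ℝ B u₀ (fderiv ℝ P (k₀, u₀) (η, 0)) a a
      + 2 * B u₀ (fderiv ℝ (fun u => fderiv ℝ P (k₀, u) (η, 0)) u₀ a) a = 0 := by
  have hP' : HasFDerivAt (fderiv ℝ P) (fderiv ℝ (fderiv ℝ P) (k₀, u₀)) (k₀, u₀) :=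
    ((hP.fderiv_right (m := ∞) (by simp)).differentiableAt (by simp)).hasFDerivAt
  have hPd : HasFDerivAt P (fderiv ℝ P (k₀, u₀)) (k₀, u₀) :=
    (hP.differentiableAt (by simp)).hasFDerivAt
  have hsnd : HasFDerivAt (fun u : E => (k₀, u)) (ContinuousLinearMap.inr ℝ F E) u₀ :=
    hasFDerivAt_prodMk_right k₀ u₀
  have hX : HasFDerivAt (fun u => fderiv ℝ P (k₀, u) (η, 0))
      (((fderiv ℝ (fderiv ℝ P) (k₀, u₀)).comp (ContinuousLinearMap.inr ℝ F E)).flip (η, 0)) u₀ := by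
    have h1 : HasFDerivAt (fun u => fderiv ℝ P (k₀, u))
        ((fderiv ℝ (fderiv ℝ P) (k₀, u₀)).comp (ContinuousLinearMap.inr ℝ F E)) u₀ :=
      HasFDerivAt.comp (g := fderiv ℝ P) (g' := fderiv ℝ (fderiv ℝ P) (k₀, u₀)) u₀ hP' hsnd
    refine (h1.clm_apply (hasFDerivAt_const ((η, 0) : F × E) u₀)).congr_fderiv ?_
    ext v; simp
  refine ⟨hX.differentiableAt, ?_⟩
  have hP_id' : fderiv ℝ P (k₀, u₀) (0, a) = a := by
    have h1 : HasFDerivAt (fun u => P (k₀, u))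
        ((fderiv ℝ P (k₀, u₀)).comp (ContinuousLinearMap.inr ℝ F E)) u₀ := hPd.comp u₀ hsnd
    have h2 := h1.unique ((hasFDerivAt_id u₀).congr_of_eventuallyEq hP_id)
    simpa using congrArg (fun D : E →L[ℝ] E => D a) h2
  have hline : HasDerivAt (fun s : ℝ => (k₀ + s • η, u₀)) (η, (0 : E)) 0 := by
    have h1 : HasDerivAt (fun s : ℝ => k₀ + s • η) ((1 : ℝ) • η) 0 :=
      ((hasDerivAt_id (0 : ℝ)).smul_const η).const_add k₀
    simpa using h1.prodMk (hasDerivAt_const (0 : ℝ) u₀)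
  have hline0 : (k₀ + (0 : ℝ) • η, u₀) = (k₀, u₀) := by simp
  have hU : HasDerivAt (fun s : ℝ => P (k₀ + s • η, u₀)) (fderiv ℝ P (k₀, u₀) (η, 0)) 0 := by
    rw [← hline0] at hPd
    have := hPd.comp_hasDerivAt (0 : ℝ) hline
    rwa [hline0] at this
  have hY : HasDerivAt (fun s : ℝ => fderiv ℝ P (k₀ + s • η, u₀) (0, a))
      (fderiv ℝ (fderiv ℝ P) (k₀, u₀) (η, 0) (0, a)) 0 := by
    have h1 : HasDerivAt (fun s : ℝ => fderiv ℝ P (k₀ + s • η, u₀))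
        (fderiv ℝ (fderiv ℝ P) (k₀, u₀) (η, 0)) 0 := by
      rw [← hline0] at hP'
      have := HasFDerivAt.comp_hasDerivAt (l := fderiv ℝ P) (l' := _) (0 : ℝ) hP' hline
      rwa [hline0] at this
    simpa using h1.clm_apply (hasDerivAt_const (0 : ℝ) ((0, a) : F × E))
  have hP0 : P (k₀, u₀) = u₀ := hP_id.self_of_nhds
  have hBU : HasDerivAt (fun s : ℝ => B (P (k₀ + s • η, u₀)))
      (fderiv ℝ B u₀ (fderiv ℝ P (k₀, u₀) (η, 0))) 0 := by
    have h1 : HasFDerivAt B (fderiv ℝ B u₀) (P (k₀ + (0 : ℝ) • η, u₀)) := by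
      rw [hline0, hP0]; exact hB.hasFDerivAt
    exact HasFDerivAt.comp_hasDerivAt (l := B) (l' := fderiv ℝ B u₀) (0 : ℝ) h1 hU
  -- The function s ↦ B(P)(∂P·a, ∂P·a) along the line k₀ + sη is differentiated in two ways: by the
  -- product rule, and as a constant by invariance.
  have htot := (hBU.clm_apply hY).clm_apply hY
  have hcont : Filter.Tendsto (fun s : ℝ => k₀ + s • η) (𝓝 0) (𝓝 k₀) := by
    have : Continuous fun s : ℝ => k₀ + s • η := by fun_prop
    simpa using this.tendsto 0
  have hconst := (hasDerivAt_const (0 : ℝ) (B u₀ a a)).congr_of_eventuallyEq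
    (hcont.eventually hP_iso)
  have hzero := htot.unique hconst
  simp only [hline0, hP0, hP_id', add_apply] at hzero
  -- Symmetry of the second derivative of P: varying the spatial differential along η is the same as
  -- differentiating the field X = ∂_η P in the direction `a`.
  have hsym : fderiv ℝ (fderiv ℝ P) (k₀, u₀) (η, 0) (0, a)
      = fderiv ℝ (fun u => fderiv ℝ P (k₀, u) (η, 0)) u₀ a := by
    rw [hX.fderiv]
    simpa using hP.isSymmSndFDerivAt (by simpa using ENat.LEInfty.out) (η, 0) (0, a)
  rw [hsym] at hzero
  have hs := hsymm a (fderiv ℝ (fun u => fderiv ℝ P (k₀, u) (η, 0)) u₀ a)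
  linear_combination hzero - hs

end Killing

/-! ### The group action in charts. -/

section Action

variable {E : Type*} [NormedAddCommGroup E] [NormedSpace ℝ E]
  {M : Type*} [TopologicalSpace M] [ChartedSpace E M] [IsManifold 𝓘(ℝ, E) ∞ M]
  {F : Type*} [NormedAddCommGroup F] [NormedSpace ℝ F]
  {G : Type*} [TopologicalSpace G] [ChartedSpace F G] [Group G] [LieGroup 𝓘(ℝ, F) ∞ G]
  [MulAction G M]

variable (G) in
/-- A group action, read in a chart of the group at `1` and in a chart of the space. -/
def actionInChart (e : OpenPartialHomeomorph M E) (z : F × E) : E :=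
  e.extend 𝓘(ℝ, E) (((chartAt F (1 : G)).extend 𝓘(ℝ, F)).symm z.1 • (e.extend 𝓘(ℝ, E)).symm z.2)

variable [ContMDiffSMul 𝓘(ℝ, F) 𝓘(ℝ, E) ∞ G M]

theorem contDiffAt_actionInChart {e : OpenPartialHomeomorph M E} (he : e ∈ atlas E M) {z : F × E}
    (hk : z.1 ∈ (chartAt F (1 : G)).target) (hu : z.2 ∈ e.target)
    (hku : ((chartAt F (1 : G)).extend 𝓘(ℝ, F)).symm z.1 • (e.extend 𝓘(ℝ, E)).symm z.2 ∈ e.source) :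
    ContDiffAt ℝ ∞ (actionInChart G e) z := by
  have h1 : ContMDiffAt 𝓘(ℝ, F × E) 𝓘(ℝ, F) ∞
      (fun z : F × E => ((chartAt F (1 : G)).extend 𝓘(ℝ, F)).symm z.1) z :=
    (contMDiffAt_extend_symm (chart_mem_atlas F (1 : G)) hk).comp z contDiff_fst.contMDiff.contMDiffAt
  have h2 : ContMDiffAt 𝓘(ℝ, F × E) 𝓘(ℝ, E) ∞
      (fun z : F × E => (e.extend 𝓘(ℝ, E)).symm z.2) z :=
    (contMDiffAt_extend_symm he hu).comp z contDiff_snd.contMDiff.contMDiffAt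
  exact contMDiffAt_iff_contDiffAt.1 ((contMDiffAt_extend he hku).comp z (h1.smul h2))

/-- The isometry property, read in a chart. -/
theorem chartMetric_actionInChart
    (g : Bundle.ContMDiffRiemannianMetric 𝓘(ℝ, E) ∞ E (fun x : M => TangentSpace 𝓘(ℝ, E) x))
    (hG : ∀ k : G, PreservesMetric 𝓘(ℝ, E) (metricTensor g) (fun q : M => k • q))
    {e : OpenPartialHomeomorph M E} (he : e ∈ atlas E M) {k : F} {u : E}
    (hk : k ∈ (chartAt F (1 : G)).target) (hu : u ∈ e.target)
    (hku : ((chartAt F (1 : G)).extend 𝓘(ℝ, F)).symm k • (e.extend 𝓘(ℝ, E)).symm u ∈ e.source)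
    (a : E) :
    chartMetric g e (actionInChart G e (k, u)) (fderiv ℝ (actionInChart G e) (k, u) (0, a))
      (fderiv ℝ (actionInChart G e) (k, u) (0, a)) = chartMetric g e u a a := by
  set m : G := ((chartAt F (1 : G)).extend 𝓘(ℝ, F)).symm k with hm
  set q : M := (e.extend 𝓘(ℝ, E)).symm u with hq
  have htgt : actionInChart G e (k, u) ∈ e.target := by
    exact e.map_source hku
  have hP : HasFDerivAt (actionInChart G e) (fderiv ℝ (actionInChart G e) (k, u)) (k, u) :=
    ((contDiffAt_actionInChart he (z := (k, u)) hk hu hku).differentiableAt (by simp)).hasFDerivAt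
  have hPu : HasFDerivAt (fun v => actionInChart G e (k, v))
      ((fderiv ℝ (actionInChart G e) (k, u)).comp (ContinuousLinearMap.inr ℝ F E)) u :=
    hP.comp u (hasFDerivAt_prodMk_right k u)
  have h1 : HasMFDerivAt 𝓘(ℝ, E) 𝓘(ℝ, E)
      ((e.extend 𝓘(ℝ, E)).symm ∘ fun v => actionInChart G e (k, v)) u _ :=
    (hasMFDerivAt_extend_symm he htgt).comp u hPu.hasMFDerivAt
  have hsm : ContMDiffAt 𝓘(ℝ, E) 𝓘(ℝ, E) ∞ (fun q : M => m • q) q :=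
    (contMDiffAt_const (I' := 𝓘(ℝ, F)) (c := m)).smul contMDiffAt_id
  have h2 : HasMFDerivAt 𝓘(ℝ, E) 𝓘(ℝ, E)
      ((fun q : M => m • q) ∘ (e.extend 𝓘(ℝ, E)).symm) u _ :=
    (hsm.mdifferentiableAt (by simp)).hasMFDerivAt.comp u (hasMFDerivAt_extend_symm he hu)
  -- Near `u` both composites are the action of `m` after the inverse chart, so their differentials
  -- agree and the isometry hypothesis passes to coordinates.
  have hev : ((e.extend 𝓘(ℝ, E)).symm ∘ fun v => actionInChart G e (k, v)) =ᶠ[𝓝 u]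
      ((fun q : M => m • q) ∘ (e.extend 𝓘(ℝ, E)).symm) := by
    have hc : ContinuousAt ((fun q : M => m • q) ∘ (e.extend 𝓘(ℝ, E)).symm) u := h2.continuousAt
    filter_upwards [hc.preimage_mem_nhds (e.open_source.mem_nhds hku)] with v hv
    exact (e.extend 𝓘(ℝ, E)).left_inv (by rw [extend_source_eq]; exact hv)
  have h3 := hasMFDerivAt_unique (h1.congr_of_eventuallyEq hev.symm) h2
  have h4 := congrArg (fun D : E →L[ℝ] E => D a) h3
  have hpt : (e.extend 𝓘(ℝ, E)).symm (actionInChart G e (k, u)) = m • q :=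
    (e.extend 𝓘(ℝ, E)).left_inv (by rw [extend_source_eq]; exact hku)
  rw [chartMetric_apply, chartMetric_apply, metricTensor_congr g hpt]
  refine Eq.trans ?_ (hG m q (chartFrame e u a : E) (chartFrame e u a : E))
  exact congrArg (fun v : E => metricTensor g (m • q) v v) h4

end Action

/-! ### Fundamental fields and conservation of moments. -/

section Moment

variable {E : Type*} [NormedAddCommGroup E] [NormedSpace ℝ E]
  {M : Type*} [TopologicalSpace M] [ChartedSpace E M] [IsManifold 𝓘(ℝ, E) ∞ M]
  {F : Type*} [NormedAddCommGroup F] [NormedSpace ℝ F]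
  {G : Type*} [TopologicalSpace G] [ChartedSpace F G] [Group G]
  [LieGroup 𝓘(ℝ, F) ∞ G] [MulAction G M] [ContMDiffSMul 𝓘(ℝ, F) 𝓘(ℝ, E) ∞ G M]

/-- The Killing equation of a fundamental vector field of an action by isometries. -/
theorem killing_equation_fundamentalField [FiniteDimensional ℝ E]
    (g : Bundle.ContMDiffRiemannianMetric 𝓘(ℝ, E) ∞ E (fun x : M => TangentSpace 𝓘(ℝ, E) x))
    (hG : ∀ k : G, PreservesMetric 𝓘(ℝ, E) (metricTensor g) (fun q : M => k • q))
    {e : OpenPartialHomeomorph M E} (he : e ∈ atlas E M) {u : E} (hu : u ∈ e.target)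
    (η : F) {X : E → E} (hX : X = fun v => fderiv ℝ (actionInChart G e)
      ((chartAt F (1 : G)).extend 𝓘(ℝ, F) 1, v) (η, 0)) (a : E) :
    DifferentiableAt ℝ X u ∧
    fderiv ℝ (chartMetric g e) u (X u) a a + 2 * chartMetric g e u (fderiv ℝ X u a) a = 0 := by
  set κ := chartAt F (1 : G) with hκ_def
  have hκ : κ ∈ atlas F G := chart_mem_atlas F 1
  have h1 : (1 : G) ∈ κ.source := mem_chart_source F 1
  have h1s : (κ.extend 𝓘(ℝ, F)).symm (κ.extend 𝓘(ℝ, F) 1) = 1 :=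
    (κ.extend 𝓘(ℝ, F)).left_inv (by rwa [extend_source_eq])
  have hk0 : κ.extend 𝓘(ℝ, F) 1 ∈ κ.target := κ.map_source h1
  have hsrc : ∀ v ∈ e.target, (e.extend 𝓘(ℝ, E)).symm v ∈ e.source := fun v hv => e.map_target hv
  have hsrc' : ∀ v ∈ e.target, (κ.extend 𝓘(ℝ, F)).symm (κ.extend 𝓘(ℝ, F) 1) •
      (e.extend 𝓘(ℝ, E)).symm v ∈ e.source := fun v hv => by
    rw [h1s, one_smul]; exact hsrc v hv
  have hid : ∀ v ∈ e.target, actionInChart G e (κ.extend 𝓘(ℝ, F) 1, v) = v := fun v hv => by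
    simp only [actionInChart]
    rw [h1s, one_smul]
    exact (e.extend 𝓘(ℝ, E)).right_inv (by rwa [extend_target_eq])
  subst hX
  refine killing_equation (P := actionInChart G e) η a
    ((contDiffAt_chartMetric g he hu).differentiableAt (by simp)) (chartMetric_symm g e u)
    (contDiffAt_actionInChart he hk0 hu (hsrc' u hu)) ?_ ?_
  · filter_upwards [e.open_target.mem_nhds hu] with v hv using hid v hv
  -- Invariance is needed only for group elements near 1, which keep the point inside the chart.
  · have hcont : ContinuousAt (fun k : F => (κ.extend 𝓘(ℝ, F)).symm k •
        (e.extend 𝓘(ℝ, E)).symm u) (κ.extend 𝓘(ℝ, F) 1) :=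
      ((contMDiffAt_extend_symm hκ hk0).smul (I' := 𝓘(ℝ, E))
        (contMDiffAt_const (c := (e.extend 𝓘(ℝ, E)).symm u))).continuousAt
    filter_upwards [κ.open_target.mem_nhds hk0,
      hcont.preimage_mem_nhds (e.open_source.mem_nhds (hsrc' u hu))] with k hk hku
    exact chartMetric_actionInChart g hG he hk hu hku a

variable [FiniteDimensional ℝ F] [T2Space G]

/-- A fundamental vector field, read in a chart. -/
theorem fundamentalField_eq_chartFrame {e : OpenPartialHomeomorph M E} (he : e ∈ atlas E M)
    (ξ : GroupLieAlgebra 𝓘(ℝ, F) G) {q : M} (hq : q ∈ e.source) :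
    (fundamentalField ξ q : E) = chartFrame e (e.extend 𝓘(ℝ, E) q)
      (fderiv ℝ (actionInChart G e)
        ((chartAt F (1 : G)).extend 𝓘(ℝ, F) 1, e.extend 𝓘(ℝ, E) q)
        (deriv (fun s => (chartAt F (1 : G)).extend 𝓘(ℝ, F) (lieExp ξ s)) 0, 0)) := by
  obtain ⟨h0, hcurve⟩ : lieExp ξ 0 = 1 ∧
      IsMIntegralCurve (lieExp ξ) (mulInvariantVectorField (I := 𝓘(ℝ, F)) (G := G) ξ) :=
    (exists_oneParameterSubgroup ξ).choose_spec
  set κ := chartAt F (1 : G)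
  have hκ : κ ∈ atlas F G := chart_mem_atlas F 1
  have h1 : (1 : G) ∈ κ.source := mem_chart_source F 1
  have hφ : MDifferentiableAt 𝓘(ℝ, ℝ) 𝓘(ℝ, F) (lieExp ξ) 0 := (hcurve 0).mdifferentiableAt
  have hφ0 : lieExp ξ 0 ∈ κ.source := by rw [h0]; exact h1
  have hk : DifferentiableAt ℝ (fun s => κ.extend 𝓘(ℝ, F) (lieExp ξ s)) 0 :=
    mdifferentiableAt_iff_differentiableAt.1
      (((contMDiffAt_extend hκ hφ0).mdifferentiableAt (by simp)).comp 0 hφ)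
  have hsmul : ContMDiffAt 𝓘(ℝ, F) 𝓘(ℝ, E) ∞ (fun k : G => k • q) (lieExp ξ 0) :=
    contMDiffAt_id.smul contMDiffAt_const
  have hc : MDifferentiableAt 𝓘(ℝ, ℝ) 𝓘(ℝ, E) (fun s : ℝ => lieExp ξ s • q) 0 :=
    (hsmul.mdifferentiableAt (by simp)).comp 0 hφ
  have hc0 : lieExp ξ 0 • q = q := by rw [h0, one_smul]
  have h2 := mfderiv_curve_eq he hc (by simpa [hc0] using hq)
  rw [hc0] at h2
  refine h2.trans (congrArg (chartFrame e (e.extend 𝓘(ℝ, E) q)) ?_)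
  have hqs : (e.extend 𝓘(ℝ, E)).symm (e.extend 𝓘(ℝ, E) q) = q :=
    (e.extend 𝓘(ℝ, E)).left_inv (by rwa [extend_source_eq])
  have h1s : ∀ k ∈ κ.source, (κ.extend 𝓘(ℝ, F)).symm (κ.extend 𝓘(ℝ, F) k) = k := fun k hk =>
    (κ.extend 𝓘(ℝ, F)).left_inv (by rwa [extend_source_eq])
  -- The orbit t ↦ e^{tξ}·q is the action in coordinates along a curve whose second component is
  -- constant, so the chain rule gives a derivative in a direction (η, 0).
  have hev : (fun s => e.extend 𝓘(ℝ, E) (lieExp ξ s • q)) =ᶠ[𝓝 0]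
      fun s => actionInChart G e (κ.extend 𝓘(ℝ, F) (lieExp ξ s), e.extend 𝓘(ℝ, E) q) := by
    filter_upwards [hφ.continuousAt.preimage_mem_nhds (κ.open_source.mem_nhds hφ0)] with s hs
    have h3 := h1s _ hs
    simp only [actionInChart]
    rw [hqs, h3]
  have hP : HasFDerivAt (actionInChart G e) (fderiv ℝ (actionInChart G e)
      (κ.extend 𝓘(ℝ, F) 1, e.extend 𝓘(ℝ, E) q)) (κ.extend 𝓘(ℝ, F) (lieExp ξ 0),
        e.extend 𝓘(ℝ, E) q) := by
    rw [h0]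
    refine ((contDiffAt_actionInChart he ?_ ?_ ?_).differentiableAt (by simp)).hasFDerivAt
    · exact κ.map_source h1
    · exact e.map_source hq
    · have h3 := h1s _ h1
      simp only
      rw [hqs, h3, one_smul]
      exact hq
  have hline := hk.hasDerivAt.prodMk (hasDerivAt_const (0 : ℝ) (e.extend 𝓘(ℝ, E) q))
  exact ((hP.comp_hasDerivAt (0 : ℝ) hline).congr_of_eventuallyEq hev).deriv

theorem metricTensor_curveVelocity_fundamentalField
    (g : Bundle.ContMDiffRiemannianMetric 𝓘(ℝ, E) ∞ E (fun x : M => TangentSpace 𝓘(ℝ, E) x))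
    {e : OpenPartialHomeomorph M E} (he : e ∈ atlas E M)
    (ξ : GroupLieAlgebra 𝓘(ℝ, F) G) {c : ℝ → M} {t : ℝ}
    (hc : MDifferentiableAt 𝓘(ℝ, ℝ) 𝓘(ℝ, E) c t) (ht : c t ∈ e.source) :
    metricTensor g (c t) (curveVelocity 𝓘(ℝ, E) c t) (fundamentalField ξ (c t))
      = chartMetric g e (e.extend 𝓘(ℝ, E) (c t)) (deriv (fun s => e.extend 𝓘(ℝ, E) (c s)) t)
        (fderiv ℝ (actionInChart G e)
          ((chartAt F (1 : G)).extend 𝓘(ℝ, F) 1, e.extend 𝓘(ℝ, E) (c t))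
          (deriv (fun s => (chartAt F (1 : G)).extend 𝓘(ℝ, F) (lieExp ξ s)) 0, 0)) := by
  rw [← metricTensor_chartFrame g ht]
  exact (congrArg (fun v : E => metricTensor g (c t) v (fundamentalField ξ (c t)))
    (mfderiv_curve_eq he hc ht)).trans (congrArg (fun v : E => metricTensor g (c t) _ v)
      (fundamentalField_eq_chartFrame he ξ ht))

variable [FiniteDimensional ℝ E]
  {g : Bundle.ContMDiffRiemannianMetric 𝓘(ℝ, E) ∞ E (fun x : M => TangentSpace 𝓘(ℝ, E) x)}
  {I₀ I₁ : ℝ → ℝ} {J : Set ℝ} {x : ℝ → M} {σ : ℝ → positiveReals}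

theorem IsWarpedGeodesic.moment_eq (h : IsWarpedGeodesic g I₀ I₁ J x σ)
    (hG : ∀ k : G, PreservesMetric 𝓘(ℝ, E) (metricTensor g) (fun q : M => k • q))
    (ξ : GroupLieAlgebra 𝓘(ℝ, F) G) {s t : ℝ} (hs : s ∈ J) (ht : t ∈ J) :
    warpedMoment g I₁ x σ (fundamentalField ξ) s
      = warpedMoment g I₁ x σ (fundamentalField ξ) t := by
  refine eq_of_hasDerivAt_zero h.isOpen h.ordConnected (fun t ht => ?_) hs ht
  have he := chart_mem_atlas E (x t)
  have hx := mem_chart_source E (x t)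
  set e := chartAt E (x t)
  obtain ⟨u, hu⟩ : ∃ u : ℝ → E, u = fun s => e.extend 𝓘(ℝ, E) (x s) := ⟨_, rfl⟩
  obtain ⟨X, hX⟩ : ∃ X : E → E, X = fun v => fderiv ℝ (actionInChart G e)
      ((chartAt F (1 : G)).extend 𝓘(ℝ, F) 1, v)
      (deriv (fun s => (chartAt F (1 : G)).extend 𝓘(ℝ, F) (lieExp ξ s)) 0, 0) := ⟨_, rfl⟩
  have hus : ContDiffAt ℝ ∞ u t := by rw [hu]; exact contDiffAt_extend_comp he (h.contMDiffAt ht) hx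
  have hut : u t ∈ e.target := by rw [hu]; exact e.map_source hx
  obtain ⟨hXd, hkill⟩ := killing_equation_fundamentalField g hG he hut _ hX (deriv u t)
  have hev : warpedMoment g I₁ x σ (fundamentalField ξ) =ᶠ[𝓝 t]
      fun s => I₁ (σ s) * chartMetric g e (u s) (deriv u s) (X (u s)) := by
    filter_upwards [h.eventually_mem_source ht hx] with s hs
    rw [hu, hX]
    exact congrArg (fun r => I₁ (σ s) * r) (metricTensor_curveVelocity_fundamentalField g he ξ
      ((h.contMDiffAt hs.1).mdifferentiableAt (by simp)) hs.2)
  have hu1 := hasDerivAt_deriv_of_contDiffAt hus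
  have hu2 := hasDerivAt_deriv_of_contDiffAt (contDiffAt_deriv_of_contDiffAt hus)
  have hd := (h.hasDerivAt_coeff₁ ht).mul
    (hasDerivAt_chartMetric g he hu1 hut hu2 (hXd.hasFDerivAt.comp_hasDerivAt t hu1))
  refine (hd.congr_of_eventuallyEq hev).congr_deriv ?_
  -- Testing on X cancels the term I₁'σ̇ B(u̇, X). What remains is (I₁/2)((∂_X B)(u̇, u̇) + 2B(∂_u̇
  -- X, u̇)), zero by Killing's equation.
  have h1 := h.equation_base ht he hx hu (X (u t))
  have h2 : I₁ (σ t) ≠ 0 := (h.pos₁ _ (σ t).2).ne'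
  have h3 := chartMetric_symm g e (u t) (deriv u t) (fderiv ℝ X (u t) (deriv u t))
  field_simp at h1
  simp only [Function.comp_apply]
  rw [h3]
  linear_combination h1 / 2 + I₁ (σ t) * hkill / 2

end Moment

/-! ### Uniqueness of geodesics and the exponential map. -/

section Uniqueness

variable {E : Type*} [NormedAddCommGroup E] [NormedSpace ℝ E]

/-- A definite bilinear form on a finite-dimensional space is nondegenerate. -/
theorem isInvertible_of_definite [FiniteDimensional ℝ E] (B : E →L[ℝ] E →L[ℝ] ℝ) (hB : ∀ v, v ≠ 0 → 0 < B v v) :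
    B.IsInvertible := by
  have hinj : Function.Injective (B : E →ₗ[ℝ] E →L[ℝ] ℝ) := by
    rw [injective_iff_map_eq_zero]
    intro v hv
    by_contra hne
    have h1 := hB v hne
    have h2 : B v = 0 := hv
    simp [h2] at h1
  have hdim : Module.finrank ℝ E = Module.finrank ℝ (E →L[ℝ] ℝ) := by
    rw [← (LinearMap.toContinuousLinearMap : (E →ₗ[ℝ] ℝ) ≃ₗ[ℝ] E →L[ℝ] ℝ).finrank_eq]
    exact Subspace.dual_finrank_eq.symm
  refine ⟨(LinearEquiv.ofInjectiveOfFinrankEq (B : E →ₗ[ℝ] E →L[ℝ] ℝ) hinj hdim)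
    |>.toContinuousLinearEquiv, ?_⟩
  ext v w
  rfl

variable {M : Type*} [TopologicalSpace M] [ChartedSpace E M] [IsManifold 𝓘(ℝ, E) ∞ M]
  (g : Bundle.ContMDiffRiemannianMetric 𝓘(ℝ, E) ∞ E (fun x : M => TangentSpace 𝓘(ℝ, E) x))

variable {g} {c : ℝ → M} {J : Set ℝ} {t : ℝ}

theorem IsGeodesicOn.contMDiffAt (hc : IsGeodesicOn 𝓘(ℝ, E) (metricTensor g) c J) (hJ : IsOpen J)
    (ht : t ∈ J) : ContMDiffAt 𝓘(ℝ, ℝ) 𝓘(ℝ, E) ∞ c t :=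
  hc.1.contMDiffAt (hJ.mem_nhds ht)

variable [FiniteDimensional ℝ E]

variable (g) in
/-- The covector `w ↦ Γ_u(v, v; w)`. -/
def christoffelCovector (e : OpenPartialHomeomorph M E) (u v : E) : E →L[ℝ] ℝ :=
  fderiv ℝ (chartMetric g e) u v v
    - (1 / 2 : ℝ) • ((fderiv ℝ (chartMetric g e) u).flip v).flip v

variable (g) in
/-- The geodesic vector field in a chart. -/
def geodesicField (e : OpenPartialHomeomorph M E) (z : E × E) : E × E :=
  (z.2, -(chartMetric g e z.1).inverse (christoffelCovector g e z.1 z.2))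

variable (g) in
theorem chartMetric_isInvertible {e : OpenPartialHomeomorph M E} (he : e ∈ atlas E M) {u : E}
    (hu : u ∈ e.target) : (chartMetric g e u).IsInvertible :=
  isInvertible_of_definite _ fun _ hv => chartMetric_pos g he hu hv

-- Operator inversion is smooth at invertible operators. The smoothness supplies the local Lipschitz
-- bound for ODE uniqueness.
variable (g) in
set_option maxSynthPendingDepth 3 in
theorem contDiffAt_geodesicField {e : OpenPartialHomeomorph M E} (he : e ∈ atlas E M) {z : E × E}
    (hz : z.1 ∈ e.target) : ContDiffAt ℝ ∞ (geodesicField g e) z := by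
  have : CompleteSpace E := FiniteDimensional.complete ℝ E
  have hopen : IsOpen (Prod.fst ⁻¹' e.target : Set (E × E)) := e.open_target.preimage continuous_fst
  have hB : ContDiffAt ℝ ∞ (fun z : E × E => chartMetric g e z.1) z :=
    (contDiffAt_chartMetric g he hz).comp z contDiffAt_fst
  have hD : ContDiffOn ℝ ∞ (fun z : E × E => fderiv ℝ (chartMetric g e) z.1)
      (Prod.fst ⁻¹' e.target) := fun y hy =>
    (((contDiffAt_chartMetric g he hy).fderiv_right (m := ∞) (by simp)).comp y
      contDiffAt_fst).contDiffWithinAt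
  have hC : ContDiffOn ℝ ∞ (fun z : E × E => christoffelCovector g e z.1 z.2)
      (Prod.fst ⁻¹' e.target) := by
    rw [contDiffOn_clm_apply]
    intro w
    have h1 := ((hD.clm_apply contDiffOn_snd).clm_apply contDiffOn_snd).clm_apply
      (contDiffOn_const (c := w))
    have h2 := ((hD.clm_apply (contDiffOn_const (c := w))).clm_apply contDiffOn_snd).clm_apply
      contDiffOn_snd
    exact (h1.sub (h2.const_smul (1 / 2 : ℝ))).congr fun _ _ => rfl
  have hinv : ContDiffAt ℝ ∞ (fun z : E × E => (chartMetric g e z.1).inverse) z :=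
    ContDiffAt.comp (g := ContinuousLinearMap.inverse) z
      (chartMetric_isInvertible g he hz).contDiffAt_map_inverse hB
  exact contDiffAt_snd.prodMk (hinv.clm_apply (hC.contDiffAt (hopen.mem_nhds hz))).neg

theorem IsGeodesicOn.hasDerivAt_geodesicField
    (hc : IsGeodesicOn 𝓘(ℝ, E) (metricTensor g) c J) (hJ : IsOpen J)
    (ht : t ∈ J) {e : OpenPartialHomeomorph M E} (he : e ∈ atlas E M) (hx : c t ∈ e.source)
    {u : ℝ → E} (hu : u = fun s => e.extend 𝓘(ℝ, E) (c s)) :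
    HasDerivAt (fun s => (u s, deriv u s)) (geodesicField g e (u t, deriv u t)) t := by
  have hus : ContDiffAt ℝ ∞ u t := by
    rw [hu]; exact contDiffAt_extend_comp he (hc.contMDiffAt hJ ht) hx
  have hut : u t ∈ e.target := by rw [hu]; exact e.map_source hx
  have h1 := hasDerivAt_deriv_of_contDiffAt hus
  have h2 := hasDerivAt_deriv_of_contDiffAt (contDiffAt_deriv_of_contDiffAt hus)
  refine (h1.prodMk h2).congr_deriv (Prod.ext rfl ?_)
  -- The geodesic equation for all w is one equation of covectors; inverting B_u solves it for ü.
  have hcov : chartMetric g e (u t) (deriv (deriv u) t)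
      = -christoffelCovector g e (u t) (deriv u t) := by
    ext w
    have h3 := hc.2 t ht e he hx w
    rw [metricInChart_eq_chartMetric, ← congrFun hu t, ← hu, christoffelInChart_eq g he hut] at h3
    simp only [christoffelCovector, neg_apply, sub_apply, smul_apply, smul_eq_mul,
      ContinuousLinearMap.flip_apply]
    linear_combination h3
  obtain ⟨A, hA⟩ := chartMetric_isInvertible g he hut
  simp only [geodesicField]
  rw [← map_neg, ← hcov, ← hA, ContinuousLinearMap.inverse_equiv]
  simp

variable {c₁ c₂ : ℝ → M} {J₁ J₂ : Set ℝ}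

/-- Both coordinate curves (u, u̇) solve the ODE of `geodesicField` with the same initial state,
near which the field is Lipschitz. -/
theorem IsGeodesicOn.eventuallyEq
    (h₁ : IsGeodesicOn 𝓘(ℝ, E) (metricTensor g) c₁ J₁) (hJ₁ : IsOpen J₁) (ht₁ : t ∈ J₁)
    (h₂ : IsGeodesicOn 𝓘(ℝ, E) (metricTensor g) c₂ J₂) (hJ₂ : IsOpen J₂) (ht₂ : t ∈ J₂)
    {e : OpenPartialHomeomorph M E} (he : e ∈ atlas E M) (hx : c₁ t ∈ e.source)
    (heq : c₁ t = c₂ t) (hderiv : deriv (fun s => e.extend 𝓘(ℝ, E) (c₁ s)) t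
      = deriv (fun s => e.extend 𝓘(ℝ, E) (c₂ s)) t) : c₁ =ᶠ[𝓝 t] c₂ := by
  have hx₂ : c₂ t ∈ e.source := heq ▸ hx
  have hut : e.extend 𝓘(ℝ, E) (c₁ t) ∈ e.target := e.map_source hx
  obtain ⟨K, S, hS, hK⟩ := (((contDiffAt_geodesicField g he
    (z := (e.extend 𝓘(ℝ, E) (c₁ t), deriv (fun s => e.extend 𝓘(ℝ, E) (c₁ s)) t)) hut).of_le
      (m := 1) (by simp)).hasStrictFDerivAt (by simp)).exists_lipschitzOnWith
  have key : ∀ (c : ℝ → M) (J : Set ℝ), IsGeodesicOn 𝓘(ℝ, E) (metricTensor g) c J → IsOpen J →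
      t ∈ J → c t ∈ e.source → (e.extend 𝓘(ℝ, E) (c t), deriv (fun s => e.extend 𝓘(ℝ, E) (c s)) t)
        = (e.extend 𝓘(ℝ, E) (c₁ t), deriv (fun s => e.extend 𝓘(ℝ, E) (c₁ s)) t) →
      ∀ᶠ s in 𝓝 t, HasDerivAt (fun s => (e.extend 𝓘(ℝ, E) (c s),
        deriv (fun r => e.extend 𝓘(ℝ, E) (c r)) s)) (geodesicField g e (e.extend 𝓘(ℝ, E) (c s),
        deriv (fun r => e.extend 𝓘(ℝ, E) (c r)) s)) s ∧ (e.extend 𝓘(ℝ, E) (c s),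
        deriv (fun r => e.extend 𝓘(ℝ, E) (c r)) s) ∈ S := by
    intro c J hc hJ ht hct hinit
    have hcont := (hc.hasDerivAt_geodesicField hJ ht he hct rfl).continuousAt
    filter_upwards [hJ.mem_nhds ht, (hc.contMDiffAt hJ ht).continuousAt.preimage_mem_nhds
      (e.open_source.mem_nhds hct), hcont.preimage_mem_nhds (t := S) (by rw [hinit]; exact hS)]
      with s hs hcs hsS
    exact ⟨hc.hasDerivAt_geodesicField hJ hs he hcs rfl, hsS⟩
  have hsol := ODE_solution_unique_of_eventually (v := fun _ => geodesicField g e)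
    (s := fun _ => S) (Filter.Eventually.of_forall fun _ => hK)
    (key c₁ J₁ h₁ hJ₁ ht₁ hx rfl) (key c₂ J₂ h₂ hJ₂ ht₂ hx₂ (by rw [hderiv, heq]))
    (by rw [hderiv, heq])
  filter_upwards [hsol, (h₁.contMDiffAt hJ₁ ht₁).continuousAt.preimage_mem_nhds
      (e.open_source.mem_nhds hx), (h₂.contMDiffAt hJ₂ ht₂).continuousAt.preimage_mem_nhds
      (e.open_source.mem_nhds hx₂)] with s hs hs₁ hs₂
  exact e.injOn hs₁ hs₂ (congrArg Prod.fst hs)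

/-- Two geodesics with the same initial velocity agree. -/
theorem IsGeodesicOn.eqOn [T2Space M]
    (h₁ : IsGeodesicOn 𝓘(ℝ, E) (metricTensor g) c₁ J₁) (hJ₁ : IsOpen J₁)
    (h₂ : IsGeodesicOn 𝓘(ℝ, E) (metricTensor g) c₂ J₂) (hJ₂ : IsOpen J₂)
    (hc₁ : J₁.OrdConnected) (hc₂ : J₂.OrdConnected) (ht₁ : t ∈ J₁) (ht₂ : t ∈ J₂)
    (hinit : (⟨c₁ t, curveVelocity 𝓘(ℝ, E) c₁ t⟩ : TangentBundle 𝓘(ℝ, E) M)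
      = ⟨c₂ t, curveVelocity 𝓘(ℝ, E) c₂ t⟩) : EqOn c₁ c₂ (J₁ ∩ J₂) := by
  have hmd : ∀ {c : ℝ → M} {J : Set ℝ} {s : ℝ}, IsGeodesicOn 𝓘(ℝ, E) (metricTensor g) c J →
      IsOpen J → s ∈ J → MDifferentiableAt 𝓘(ℝ, ℝ) 𝓘(ℝ, E) c s := fun hc hJ hs =>
    (hc.contMDiffAt hJ hs).mdifferentiableAt (by simp)
  -- The set of times where the germs agree is open; it is shown to be relatively closed in the
  -- interval `J₁ ∩ J₂`, and connectedness concludes.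
  have hsub : J₁ ∩ J₂ ⊆ {s | c₁ =ᶠ[𝓝 s] c₂} := by
    refine (hc₁.inter hc₂).isPreconnected.subset_of_closure_inter_subset
      isOpen_setOfPred_eventually_nhds ⟨t, ⟨ht₁, ht₂⟩, ?_⟩ ?_
    · have heq : c₁ t = c₂ t := congrArg Bundle.TotalSpace.proj hinit
      have hvel : (mfderiv 𝓘(ℝ, ℝ) 𝓘(ℝ, E) c₁ t (1 : ℝ) : E)
          = (mfderiv 𝓘(ℝ, ℝ) 𝓘(ℝ, E) c₂ t (1 : ℝ) : E) :=
        congrArg (fun z : TangentBundle 𝓘(ℝ, E) M => (z.2 : E)) hinit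
      have he := chart_mem_atlas E (c₁ t)
      have hx := mem_chart_source E (c₁ t)
      refine h₁.eventuallyEq hJ₁ ht₁ h₂ hJ₂ ht₂ he hx heq ?_
      have hut : (chartAt E (c₁ t)).extend 𝓘(ℝ, E) (c₁ t) ∈ (chartAt E (c₁ t)).target :=
        (chartAt E (c₁ t)).map_source hx
      have hv₁ := mfderiv_curve_eq he (hmd h₁ hJ₁ ht₁) hx
      have hv₂ := mfderiv_curve_eq he (hmd h₂ hJ₂ ht₂) (heq ▸ hx)
      apply chartFrame_injective he hut
      rw [← heq] at hv₂
      exact hv₁.symm.trans (hvel.trans hv₂)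
    · rintro s ⟨hs, hs₁, hs₂⟩
      -- At a limit of such times, positions agree since `M` is Hausdorff, and coordinate velocities
      -- agree by continuity; local uniqueness applies again.
      have hfreq : ∃ᶠ r in 𝓝 s, c₁ =ᶠ[𝓝 r] c₂ := mem_closure_iff_frequently.1 hs
      have heq : c₁ s = c₂ s := tendsto_nhds_unique_of_frequently_eq
        (h₁.contMDiffAt hJ₁ hs₁).continuousAt (h₂.contMDiffAt hJ₂ hs₂).continuousAt
        (hfreq.mono fun r hr => hr.self_of_nhds)
      have he := chart_mem_atlas E (c₁ s)
      have hx := mem_chart_source E (c₁ s)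
      refine h₁.eventuallyEq hJ₁ hs₁ h₂ hJ₂ hs₂ he hx heq ?_
      refine tendsto_nhds_unique_of_frequently_eq
        (contDiffAt_deriv_of_contDiffAt (contDiffAt_extend_comp he
          (h₁.contMDiffAt hJ₁ hs₁) hx)).continuousAt
        (contDiffAt_deriv_of_contDiffAt (contDiffAt_extend_comp he
          (h₂.contMDiffAt hJ₂ hs₂) (heq ▸ hx))).continuousAt (hfreq.mono fun r hr => ?_)
      exact (hr.fun_comp ((chartAt E (c₁ s)).extend 𝓘(ℝ, E))).deriv_eq
  exact fun s hs => (hsub hs).self_of_nhds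

/-- The geodesic chosen in the definition need not be `c`, but uniqueness makes both agree at 1,
since both intervals contain [0, 1]. -/
theorem riemannianExp_eq [T2Space M] {p : M} {v : TangentSpace 𝓘(ℝ, E) p}
    (hc : IsExpGeodesic 𝓘(ℝ, E) (metricTensor g) p v c) :
    riemannianExp 𝓘(ℝ, E) (metricTensor g) p v = c 1 := by
  have hex : ∃ c : ℝ → M, IsExpGeodesic 𝓘(ℝ, E) (metricTensor g) p v c := ⟨c, hc⟩
  rw [riemannianExp, dif_pos hex]
  obtain ⟨⟨J₁, hJ₁, hc₁, hI₁, h₁⟩, hi₁⟩ := hex.choose_spec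
  obtain ⟨⟨J₂, hJ₂, hc₂, hI₂, h₂⟩, hi₂⟩ := hc
  have h0 : (0 : ℝ) ∈ Icc (0 : ℝ) 1 := by simp
  have h1 : (1 : ℝ) ∈ Icc (0 : ℝ) 1 := by simp
  exact h₁.eqOn hJ₁ h₂ hJ₂ hc₁ hc₂ (hI₁ h0) (hI₂ h0) (hi₁.trans hi₂.symm) ⟨hI₁ h1, hI₂ h1⟩

end Uniqueness

/-! ### Change of time and smooth inverses. -/

section Reparametrization

variable {E : Type*} [NormedAddCommGroup E] [NormedSpace ℝ E] [FiniteDimensional ℝ E]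
  {M : Type*} [TopologicalSpace M] [ChartedSpace E M] [IsManifold 𝓘(ℝ, E) ∞ M]
  {g : Bundle.ContMDiffRiemannianMetric 𝓘(ℝ, E) ∞ E (fun x : M => TangentSpace 𝓘(ℝ, E) x)}
  {I₀ I₁ : ℝ → ℝ} {J : Set ℝ} {x : ℝ → M} {σ : ℝ → positiveReals} {t : ℝ}

/-- The component along `M` of a geodesic of a warped metric is a geodesic of `M` up to a change of
parameter. -/
theorem IsWarpedGeodesic.isGeodesicOn_comp (h : IsWarpedGeodesic g I₀ I₁ J x σ) {K : Set ℝ}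
    (hK : IsOpen K) {r : ℝ → ℝ} (hr : ∀ s ∈ K, ContDiffAt ℝ ∞ r s) (hrJ : ∀ s ∈ K, r s ∈ J) (k : ℝ)
    (hr' : ∀ s ∈ K, HasDerivAt r (k * I₁ (σ (r s))) s) :
    IsGeodesicOn 𝓘(ℝ, E) (metricTensor g) (fun s => x (r s)) K := by
  refine ⟨fun s hs => ((h.contMDiffAt (hrJ s hs)).comp s (hr s hs).contMDiffAt).contMDiffWithinAt,
    fun t ht e he hx w => ?_⟩
  obtain ⟨u, hu⟩ : ∃ u : ℝ → E, u = fun s => e.extend 𝓘(ℝ, E) (x s) := ⟨_, rfl⟩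
  have hU : (fun s => e.extend 𝓘(ℝ, E) (x (r s))) = fun s => u (r s) := by rw [hu]
  have hUt : e.extend 𝓘(ℝ, E) (x (r t)) = u (r t) := by rw [hu]
  have hus : ∀ s ∈ J, x s ∈ e.source → ContDiffAt ℝ ∞ u s := fun s hs hxs => by
    rw [hu]; exact contDiffAt_extend_comp he (h.contMDiffAt hs) hxs
  have hut : u (r t) ∈ e.target := by rw [hu]; exact e.map_source hx
  have hxr : ContinuousAt (fun s => x (r s)) t :=
    ((h.contMDiffAt (hrJ t ht)).continuousAt.comp (hr t ht).continuousAt)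
  have hd : deriv (fun s => u (r s)) =ᶠ[𝓝 t]
      fun s => (k * I₁ (σ (r s))) • deriv u (r s) := by
    filter_upwards [hK.mem_nhds ht, hxr.preimage_mem_nhds (e.open_source.mem_nhds hx)] with s hs hxs
    exact ((hasDerivAt_deriv_of_contDiffAt (hus _ (hrJ s hs) hxs)).scomp s (hr' s hs)).deriv
  have hu₁ := hus _ (hrJ t ht) hx
  have hdd := ((((h.hasDerivAt_coeff₁ (hrJ t ht)).comp t (hr' t ht)).const_mul k).smul
    ((hasDerivAt_deriv_of_contDiffAt (contDiffAt_deriv_of_contDiffAt hu₁)).scomp t (hr' t ht)))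
  have hdd' := (hdd.congr_of_eventuallyEq hd).deriv
  rw [hU, hUt, hdd', hd.self_of_nhds, metricInChart_eq_chartMetric, christoffelInChart_eq g he hut]
  -- The acceleration of u∘r is r'²ü + r''u̇. Since r' = k I₁(σ∘r), one has r'' = r'² I₁'σ̇/I₁,
  -- which cancels the right-hand side of r'² times the base equation.
  have h1 := h.equation_base (hrJ t ht) he hx hu w
  have h2 : I₁ (σ (r t)) ≠ 0 := (h.pos₁ _ (σ (r t)).2).ne'
  field_simp at h1
  simp only [Function.comp_apply, map_add, map_smul, add_apply, smul_apply, smul_eq_mul]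
  linear_combination (k ^ 2 * I₁ (σ (r t)) / 2) * h1

/-- A smooth function with positive derivative on an open interval has a smooth inverse. -/
theorem exists_smooth_inverse {f : ℝ → ℝ} (hJ : IsOpen J) (hJc : J.OrdConnected)
    (hf : ContDiffOn ℝ ∞ f J) (hf' : ∀ t ∈ J, 0 < deriv f t) :
    ∃ ρ : ℝ → ℝ, IsOpen (f '' J) ∧ (f '' J).OrdConnected ∧ (∀ t ∈ J, ρ (f t) = t) ∧
      ∀ t ∈ J, ContDiffAt ℝ ∞ ρ (f t) ∧ HasDerivAt ρ (deriv f t)⁻¹ (f t) := by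
  have hfa : ∀ t ∈ J, ContDiffAt ℝ ∞ f t := fun t ht => hf.contDiffAt (hJ.mem_nhds ht)
  have hinj : InjOn f J := (strictMonoOn_of_deriv_pos hJc.convex hf.continuousOn
    fun t ht => hf' t (interior_subset ht)).injOn
  have hopen : IsOpenMap (J.domRestrict f) := by
    refine IsOpenMap.of_nhds_le fun t => ?_
    have h1 : HasStrictDerivAt f (deriv f t) t := (hfa t t.2).hasStrictDerivAt (by simp)
    have h2 := h1.map_nhds_eq (hf' t t.2).ne'
    have h3 : J.domRestrict f = f ∘ Subtype.val := rfl
    rw [h3, ← Filter.map_map, hJ.isOpenEmbedding_subtypeVal.map_nhds_eq, h2]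
    rfl
  let φ : OpenPartialHomeomorph ℝ ℝ := OpenPartialHomeomorph.ofContinuousOpenRestrict
    (hinj.toPartialEquiv f J) hf.continuousOn hopen hJ
  have hφ : ∀ t ∈ J, φ.symm (f t) = t := fun t ht => φ.left_inv ht
  refine ⟨φ.symm, φ.open_target, (hJc.isPreconnected.image f hf.continuousOn).ordConnected, hφ,
    fun t ht => ⟨?_, ?_⟩⟩
  · refine φ.contDiffAt_symm_deriv (f₀' := deriv f t) (hf' t ht).ne' (φ.map_source ht) ?_ ?_
    · rw [hφ t ht]; exact hasDerivAt_deriv_of_contDiffAt (hfa t ht)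
    · rw [hφ t ht]; exact hfa t ht
  · refine φ.hasDerivAt_symm (φ.map_source ht) (hf' t ht).ne' ?_
    rw [hφ t ht]; exact hasDerivAt_deriv_of_contDiffAt (hfa t ht)

end Reparametrization

/-! ### Separation of variables. -/

section Quadrature

/-- Separation of variables: `q̇ = ± 1 / f(q)` on `(a, b)` implies that `b - a` is, up to the sign of
`q̇`, the integral of `f` from `q(a)` to `q(b)`. -/
theorem exists_sign_integral_eq_of_abs_deriv_mul_eq_one {q q' f : ℝ → ℝ} {a b : ℝ} (hab : a < b)
    (hq : ∀ s ∈ Icc a b, HasDerivAt q (q' s) s) (hne : ∀ s ∈ Ioo a b, q' s ≠ 0)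
    (hf : ∀ s ∈ Ioo a b, |q' s| * f (q s) = 1) :
    ∃ ε : ℝ, (ε = 1 ∨ ε = -1) ∧ (∀ s ∈ Ioo a b, 0 < ε * q' s) ∧
      IntervalIntegrable f volume (q a) (q b) ∧ b - a = ε * ∫ s in (q a)..(q b), f s := by
  have hcont : ContinuousOn q (Icc a b) := fun s hs => (hq s hs).continuousAt.continuousWithinAt
  have hq_int : ∀ s ∈ Ioo a b, HasDerivWithinAt q (q' s) (Ioo a b) s := fun s hs =>
    (hq s (Ioo_subset_Icc_self hs)).hasDerivWithinAt
  have hsub : ∀ {s}, s ∈ Ioo a b → s ∈ Icc a b := fun hs => Ioo_subset_Icc_self hs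
  have hl : a ∈ Icc a b := left_mem_Icc.2 hab.le
  have hr : b ∈ Icc a b := right_mem_Icc.2 hab.le
  -- Change of variables turns `f` on the image into |q'|·f(q) = 1 on (a, b), giving integrability
  -- and the value b - a. The open interval avoids the endpoints, where q' may vanish.
  have key : InjOn q (Ioo a b) →
      IntegrableOn f (q '' Ioo a b) ∧ ∫ s in q '' Ioo a b, f s = b - a := by
    intro hinj
    rw [integrableOn_image_iff_integrableOn_abs_deriv_smul measurableSet_Ioo hq_int hinj,
      integral_image_eq_integral_abs_deriv_smul measurableSet_Ioo hq_int hinj]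
    simp only [smul_eq_mul]
    refine ⟨(integrableOn_congr_fun hf measurableSet_Ioo).2 (by simp), ?_⟩
    rw [setIntegral_congr_fun measurableSet_Ioo hf]
    simp [hab.le]
  have hderiv : ∀ s ∈ interior (Icc a b), deriv q s = q' s := fun s hs =>
    (hq s (interior_subset hs)).deriv
  -- By Darboux's theorem a derivative without zeros has constant sign.
  rcases hasDerivWithinAt_forall_lt_or_forall_gt_of_forall_ne (convex_Ioo a b) hq_int hne
    with hneg | hpos
  · have hanti : StrictAntiOn q (Icc a b) := strictAntiOn_of_deriv_neg (convex_Icc a b) hcont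
      fun s hs => by rw [hderiv s hs]; rw [interior_Icc] at hs; exact hneg s hs
    have himage : q '' Ioo a b = Ioo (q b) (q a) := by
      refine Subset.antisymm ?_ (intermediate_value_Ioo' hab.le hcont)
      rintro _ ⟨s, hs, rfl⟩
      exact ⟨hanti (hsub hs) hr hs.2, hanti hl (hsub hs) hs.1⟩
    have hle : q b ≤ q a := (hanti hl hr hab).le
    obtain ⟨h1, h2⟩ := key (hanti.injOn.mono Ioo_subset_Icc_self)
    rw [himage] at h1 h2
    refine ⟨-1, Or.inr rfl, fun s hs => by linarith [hneg s hs], ?_, ?_⟩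
    · refine IntervalIntegrable.symm ?_
      rwa [intervalIntegrable_iff_integrableOn_Ioc_of_le hle, integrableOn_Ioc_iff_integrableOn_Ioo]
    · rw [intervalIntegral.integral_symm, intervalIntegral.integral_of_le hle,
        integral_Ioc_eq_integral_Ioo, h2]
      ring
  · have hmono : StrictMonoOn q (Icc a b) := strictMonoOn_of_deriv_pos (convex_Icc a b) hcont
      fun s hs => by rw [hderiv s hs]; rw [interior_Icc] at hs; exact hpos s hs
    have himage : q '' Ioo a b = Ioo (q a) (q b) := by
      refine Subset.antisymm ?_ (intermediate_value_Ioo hab.le hcont)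
      rintro _ ⟨s, hs, rfl⟩
      exact ⟨hmono hl (hsub hs) hs.1, hmono (hsub hs) hr hs.2⟩
    have hle : q a ≤ q b := (hmono hl hr hab).le
    obtain ⟨h1, h2⟩ := key (hmono.injOn.mono Ioo_subset_Icc_self)
    rw [himage] at h1 h2
    refine ⟨1, Or.inl rfl, fun s hs => by linarith [hpos s hs], ?_, ?_⟩
    · rwa [intervalIntegrable_iff_integrableOn_Ioc_of_le hle, integrableOn_Ioc_iff_integrableOn_Ioo]
    · rw [intervalIntegral.integral_of_le hle, integral_Ioc_eq_integral_Ioo, h2]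
      ring

end Quadrature

/-! ### The formulas for σ(t) and x(t). -/

section Main

variable {E : Type*} [NormedAddCommGroup E] [NormedSpace ℝ E]
  {M : Type*} [TopologicalSpace M] [ChartedSpace E M]

theorem tangentBundle_mk_congr {p q : M} (hpq : p = q) {v w : E} (hvw : v = w) :
    (⟨p, v⟩ : TangentBundle 𝓘(ℝ, E) M) = ⟨q, w⟩ := by
  subst hpq hvw; rfl

variable [FiniteDimensional ℝ E] [IsManifold 𝓘(ℝ, E) ∞ M]
  {g : Bundle.ContMDiffRiemannianMetric 𝓘(ℝ, E) ∞ E (fun x : M => TangentSpace 𝓘(ℝ, E) x)}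
  {I₀ I₁ : ℝ → ℝ} {J : Set ℝ} {x : ℝ → M} {σ : ℝ → positiveReals} {t₀ t : ℝ}

theorem IsWarpedGeodesic.exists_sign_sub_eq_integral (h : IsWarpedGeodesic g I₀ I₁ J x σ)
    (h0 : 0 ∈ J) (ht₀ : t₀ ∈ J) (ht : t ∈ J)
    (hne : ∀ s ∈ uIoo t₀ t, deriv (fun r => (σ r : ℝ)) s ≠ 0) :
    ∃ ε : ℝ, (ε = 1 ∨ ε = -1) ∧ (∀ s ∈ uIoo t₀ t, 0 < ε * deriv (fun r => (σ r : ℝ)) s) ∧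
      IntervalIntegrable (fun s => √(I₀ s) /
        √(warpedEnergy g I₀ I₁ x σ 0 - warpedPotential g I₁ x σ s)) volume (σ t₀) (σ t) ∧
      t - t₀ = ε * ∫ s in (σ t₀ : ℝ)..(σ t), √(I₀ s) /
        √(warpedEnergy g I₀ I₁ x σ 0 - warpedPotential g I₁ x σ s) := by
  -- Since √(E - V(σ)) = √I₀(σ)·|σ̇|, the integrand at σ(s) is 1/|σ̇(s)|.
  have hf : ∀ s ∈ J, deriv (fun r => (σ r : ℝ)) s ≠ 0 → |deriv (fun r => (σ r : ℝ)) s| *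
      (√(I₀ (σ s)) / √(warpedEnergy g I₀ I₁ x σ 0 - warpedPotential g I₁ x σ (σ s))) = 1 := by
    intro s hs hs'
    have hI : 0 < I₀ (σ s) := h.pos₀ _ (σ s).2
    rw [← h.energy_sub_potential h0 hs, Real.sqrt_mul hI.le, Real.sqrt_sq_eq_abs]
    have h1 : √(I₀ (σ s)) ≠ 0 := (Real.sqrt_pos.2 hI).ne'
    have h2 : |deriv (fun r => (σ r : ℝ)) s| ≠ 0 := abs_ne_zero.2 hs'
    field_simp
  have hIcc : ∀ {a b : ℝ}, a ∈ J → b ∈ J → Icc a b ⊆ J := fun ha hb => h.ordConnected.out ha hb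
  rcases lt_trichotomy t₀ t with hlt | rfl | hlt
  · rw [uIoo_of_lt hlt] at hne ⊢
    exact exists_sign_integral_eq_of_abs_deriv_mul_eq_one (q := fun s => (σ s : ℝ)) hlt
      (fun s hs => h.hasDerivAt_coe (hIcc ht₀ ht hs)) hne
      (fun s hs => hf s (hIcc ht₀ ht (Ioo_subset_Icc_self hs)) (hne s hs))
  · exact ⟨1, Or.inl rfl, by simp, by simp, by simp⟩
  -- For t < t₀ the formula on [t, t₀] is used; exchanging the endpoints changes the sign of both
  -- sides and keeps ε.
  · rw [uIoo_of_gt hlt] at hne ⊢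
    obtain ⟨ε, h1, h2, h3, h4⟩ := exists_sign_integral_eq_of_abs_deriv_mul_eq_one
      (q := fun s => (σ s : ℝ)) (f := fun s => √(I₀ s) /
        √(warpedEnergy g I₀ I₁ x σ 0 - warpedPotential g I₁ x σ s)) hlt
      (fun s hs => h.hasDerivAt_coe (hIcc ht ht₀ hs)) hne
      (fun s hs => hf s (hIcc ht ht₀ (Ioo_subset_Icc_self hs)) (hne s hs))
    refine ⟨ε, h1, h2, h3.symm, ?_⟩
    rw [intervalIntegral.integral_symm]
    linarith

/-- With ρ the inverse of τ and a = τ(t), the curve c(s) = x(ρ(sa)) works. The factor a puts x(t) at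
parameter 1 and covers negative t, as well as t = 0, where c is constant. -/
theorem IsWarpedGeodesic.exists_isExpGeodesic (h : IsWarpedGeodesic g I₀ I₁ J x σ) (h0 : 0 ∈ J)
    (ht : t ∈ J) : ∃ c : ℝ → M, c 1 = x t ∧ IsExpGeodesic 𝓘(ℝ, E) (metricTensor g) (x 0)
      ((∫ s in (0 : ℝ)..t, I₁ (σ 0) / I₁ (σ s)) • curveVelocity 𝓘(ℝ, E) x 0) c := by
  have hI₁ : ∀ s, 0 < I₁ (σ s) := fun s => h.pos₁ _ (σ s).2
  have hsmooth : ContDiffOn ℝ ∞ (fun s => I₁ (σ 0) / I₁ (σ s)) J := fun s hs =>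
    (contDiffAt_const.div ((h.smooth₁.contDiffAt (Ioi_mem_nhds (σ s).2)).comp s (h.contDiffAt hs))
      (hI₁ s).ne').contDiffWithinAt
  obtain ⟨τ, hτ⟩ : ∃ τ : ℝ → ℝ, τ = fun t => ∫ s in (0 : ℝ)..t, I₁ (σ 0) / I₁ (σ s) := ⟨_, rfl⟩
  have hτ' : ∀ s ∈ J, HasDerivAt τ (I₁ (σ 0) / I₁ (σ s)) s := fun s hs => by
    rw [hτ]
    exact intervalIntegral.integral_hasDerivAt_right
      (hsmooth.continuousOn.mono (h.ordConnected.uIcc_subset h0 hs)).intervalIntegrable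
      (hsmooth.continuousOn.stronglyMeasurableAtFilter h.isOpen s hs)
      (hsmooth.continuousOn.continuousAt (h.isOpen.mem_nhds hs))
  have hτ_smooth : ContDiffOn ℝ ∞ τ J := (contDiffOn_infty_iff_deriv_of_isOpen h.isOpen).2
    ⟨fun s hs => (hτ' s hs).differentiableAt.differentiableWithinAt,
      hsmooth.congr fun s hs => (hτ' s hs).deriv⟩
  obtain ⟨ρ, hopen, hconn, hρ, hρ'⟩ := exists_smooth_inverse h.isOpen h.ordConnected hτ_smooth
    (fun s hs => by rw [(hτ' s hs).deriv]; exact div_pos (hI₁ 0) (hI₁ s))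
  have hτ0 : τ 0 = 0 := by rw [hτ]; simp
  obtain ⟨a, ha⟩ : ∃ a, a = τ t := ⟨_, rfl⟩
  have hav : (∫ s in (0 : ℝ)..t, I₁ (σ 0) / I₁ (σ s)) = a := by rw [ha, hτ]
  rw [hav]
  have h0mem : (0 : ℝ) ∈ τ '' J := ⟨0, h0, hτ0⟩
  have hamem : a ∈ τ '' J := ⟨t, ht, ha.symm⟩
  have hρ0 : ρ 0 = 0 := by rw [← hτ0, hρ 0 h0, hτ0]
  -- These are the parameters at which c is controlled: an open interval, containing [0, 1] because
  -- the interval τ(J) contains 0 and a.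
  set K : Set ℝ := (fun s => s * a) ⁻¹' (τ '' J) with hK
  have hK_open : IsOpen K := hopen.preimage (by fun_prop)
  have hK_conn : K.OrdConnected := by
    rw [← convex_iff_ordConnected] at hconn ⊢
    exact hconn.is_linear_preimage (f := fun s : ℝ => s * a)
      ⟨fun _ _ => add_mul _ _ _, fun _ _ => smul_mul_assoc _ _ _⟩
  have hK_Icc : Icc 0 1 ⊆ K := fun s hs => by
    refine hconn.uIcc_subset h0mem hamem ?_
    rcases le_total 0 a with h1 | h1
    · rw [uIcc_of_le h1]
      exact ⟨mul_nonneg hs.1 h1, mul_le_of_le_one_left h1 hs.2⟩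
    · rw [uIcc_of_ge h1]
      exact ⟨by nlinarith [hs.2], mul_nonpos_of_nonneg_of_nonpos hs.1 h1⟩
  have hmul : ∀ s, HasDerivAt (fun s : ℝ => s * a) a s := fun s => by
    simpa using (hasDerivAt_id s).mul_const a
  -- The derivative of ρ(sa) is a/τ' = (a/I₁(σ(0)))·I₁(σ), the form required for the change of time,
  -- with k = a/I₁(σ(0)).
  have hr : ∀ s ∈ K, ContDiffAt ℝ ∞ (fun s => ρ (s * a)) s ∧ ρ (s * a) ∈ J ∧
      HasDerivAt (fun s => ρ (s * a)) (a / I₁ (σ 0) * I₁ (σ (ρ (s * a)))) s := by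
    rintro s ⟨y, hy, hys⟩
    simp only at hys
    have h1 : ρ (s * a) = y := by rw [← hys]; exact hρ y hy
    obtain ⟨h2, h3⟩ := hρ' y hy
    rw [hys] at h2 h3
    refine ⟨h2.comp s (by fun_prop), h1 ▸ hy, (h3.comp s (hmul s)).congr_deriv ?_⟩
    rw [h1, (hτ' y hy).deriv]
    have := (hI₁ 0).ne'
    have := (hI₁ y).ne'
    field_simp
  have hK0 : (0 : ℝ) ∈ K := hK_Icc (by simp)
  have hr0 : ρ (0 * a) = 0 := by rw [zero_mul, hρ0]
  refine ⟨fun s => x (ρ (s * a)), ?_, ⟨K, hK_open, hK_conn, hK_Icc,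
    h.isGeodesicOn_comp hK_open (fun s hs => (hr s hs).1) (fun s hs => (hr s hs).2.1) _
      (fun s hs => (hr s hs).2.2)⟩, ?_⟩
  · simp only [one_mul]
    rw [ha, hρ t ht]
  · refine tangentBundle_mk_congr (congrArg x hr0) ?_
    let D : ℝ →L[ℝ] E := mfderiv 𝓘(ℝ, ℝ) 𝓘(ℝ, E) x 0
    have hx0 : HasMFDerivAt 𝓘(ℝ, ℝ) 𝓘(ℝ, E) x 0 D :=
      ((h.contMDiffAt h0).mdifferentiableAt (by simp)).hasMFDerivAt
    have hx : HasMFDerivAt 𝓘(ℝ, ℝ) 𝓘(ℝ, E) x (ρ (0 * a)) D := by rw [hr0]; exact hx0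
    -- At s = 0 the factor I₁(σ(0)) cancels and the change of time has derivative a, so the initial
    -- velocity is a·ẋ(0).
    have hr0' := (hr 0 hK0).2.2
    rw [hr0, div_mul_cancel₀ _ (hI₁ 0).ne'] at hr0'
    have h1 := hx.comp (0 : ℝ) hr0'.hasFDerivAt.hasMFDerivAt
    have h2 := congrArg (fun A : ℝ →L[ℝ] E => A 1) h1.mfderiv
    refine h2.trans ?_
    change D ((1 : ℝ) • a) = a • D 1
    rw [← map_smul, smul_eq_mul, smul_eq_mul, one_mul, mul_one]

end Main

end

theorem proposition2
    -- the Riemannian manifold `M` with its metric `g`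
    {E : Type*} [NormedAddCommGroup E] [NormedSpace ℝ E] [FiniteDimensional ℝ E]
    {M : Type*} [TopologicalSpace M] [T2Space M] [ChartedSpace E M] [IsManifold 𝓘(ℝ, E) ∞ M]
    (g : Bundle.ContMDiffRiemannianMetric 𝓘(ℝ, E) ∞ E (fun x : M => TangentSpace 𝓘(ℝ, E) x))
    -- the Lie group `G` of isometries of `M`
    {F : Type*} [NormedAddCommGroup F] [NormedSpace ℝ F] [FiniteDimensional ℝ F]
    {G : Type*} [TopologicalSpace G] [T2Space G] [ChartedSpace F G] [Group G]
    [LieGroup 𝓘(ℝ, F) ∞ G] [MulAction G M] [ContMDiffSMul 𝓘(ℝ, F) 𝓘(ℝ, E) ∞ G M]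
    (hG : ∀ k : G, PreservesMetric 𝓘(ℝ, E) (metricTensor g) (fun q : M => k • q))
    -- the coefficients of the warped metric
    (I₀ I₁ : ℝ → ℝ)
    (hI₀ : ContDiffOn ℝ ∞ I₀ (Ioi 0)) (hI₁ : ContDiffOn ℝ ∞ I₁ (Ioi 0))
    (hI₀_pos : ∀ s, 0 < s → 0 < I₀ s) (hI₁_pos : ∀ s, 0 < s → 0 < I₁ s)
    -- a geodesic `γ = (x, σ)` of the warped metric, on an open interval `J` that contains `0`
    (J : Set ℝ) (hJ_open : IsOpen J) (hJ_conn : J.OrdConnected) (hJ_zero : (0 : ℝ) ∈ J)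
    (x : ℝ → M) (σ : ℝ → positiveReals)
    (hγ : IsGeodesicOn (𝓘(ℝ, E).prod 𝓘(ℝ, ℝ)) (warpedMetric g I₀ I₁) (fun t => (x t, σ t)) J) :
    -- conservation of energy
    (∀ s ∈ J, ∀ t ∈ J, warpedEnergy g I₀ I₁ x σ s = warpedEnergy g I₀ I₁ x σ t) ∧
    -- conservation of moments
    (∀ ξ : GroupLieAlgebra 𝓘(ℝ, F) G, ∀ s ∈ J, ∀ t ∈ J,
      warpedMoment g I₁ x σ (fundamentalField ξ) s
        = warpedMoment g I₁ x σ (fundamentalField ξ) t) ∧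
    (IsIrreducibleSymmetricSpace 𝓘(ℝ, E) (metricTensor g) G →
      -- the equation of `x(t)`
      (∀ t ∈ J,
        (∫ s in (0 : ℝ)..t, I₁ (σ 0) / I₁ (σ s)) • curveVelocity 𝓘(ℝ, E) x 0
            ∈ riemannianExpDomain 𝓘(ℝ, E) (metricTensor g) (x 0) ∧
        x t = riemannianExp 𝓘(ℝ, E) (metricTensor g) (x 0)
          ((∫ s in (0 : ℝ)..t, I₁ (σ 0) / I₁ (σ s)) • curveVelocity 𝓘(ℝ, E) x 0)) ∧
      -- the first-order equation of `σ(t)`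
      (∀ t ∈ J, I₀ (σ t) * (deriv (fun s => (σ s : ℝ)) t) ^ 2
        = warpedEnergy g I₀ I₁ x σ 0 - warpedPotential g I₁ x σ (σ t)) ∧
      -- its integrated form, between two times without a zero of `σ̇` strictly between them
      (∀ t₀ ∈ J, ∀ t ∈ J, (∀ s ∈ uIoo t₀ t, deriv (fun r => (σ r : ℝ)) s ≠ 0) →
        ∃ ε : ℝ, (ε = 1 ∨ ε = -1) ∧ (∀ s ∈ uIoo t₀ t, 0 < ε * deriv (fun r => (σ r : ℝ)) s) ∧
          IntervalIntegrable (fun s => √(I₀ s) /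
            √(warpedEnergy g I₀ I₁ x σ 0 - warpedPotential g I₁ x σ s)) volume (σ t₀) (σ t) ∧
          t - t₀ = ε * ∫ s in (σ t₀ : ℝ)..(σ t), √(I₀ s) /
            √(warpedEnergy g I₀ I₁ x σ 0 - warpedPotential g I₁ x σ s))) := by
  have h : IsWarpedGeodesic g I₀ I₁ J x σ :=
    ⟨hI₀, hI₁, hI₀_pos, hI₁_pos, hJ_open, hJ_conn, hγ⟩
  refine ⟨fun s hs t ht => h.energy_eq hs ht, fun ξ s hs t ht => h.moment_eq hG ξ hs ht,
    fun _ => ⟨fun t ht => ?_, fun t ht => h.energy_sub_potential hJ_zero ht,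
      fun t₀ ht₀ t ht hne => h.exists_sign_sub_eq_integral hJ_zero ht₀ ht hne⟩⟩
  -- The warped-product geodesic equation alone gives the formula for `x(t)`.
  obtain ⟨c, hc1, hc⟩ := h.exists_isExpGeodesic hJ_zero ht
  exact ⟨⟨c, hc⟩, by rw [riemannianExp_eq hc, hc1]⟩
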